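/- **Conventions.** A *monoidal Garside structure* is a pair $(A^+,\Delta)$, where $A^+$ is a cancellative monoid that is noetherian (every sequence in which each term is a factor of the preceding one stabilizes), in which any two elements have an lcm and a gcd for left-divisibility and also for right-divisibility, and $\Delta\in A^+$ is such that $v\Delta=\Delta\Phi(v)$ for an automorphism $\Phi$ of $A^+$ and every atom $v$ satisfies $v\bar v=\Delta$ and $\bar v\,\Phi(v)=\Delta$ for some $\bar v\in A^+$. Let $S$ be the set of atoms of $A^+$ and $A\supseteq A^+$ its group of fractions. A submonoid $P\subseteq A^+$ is *parabolic* if it is closed under lcm's and gcd's on both sides and there is $\delta\in A^+$ with $P\delta=\delta P$ and $$\{w : w\preceq\delta\}=\{w : w\preceq\Delta\}\cap P=\{\Delta\wedge p : p\in P\},$$ where $\preceq$ and $\wedge$ denote left-divisibility in $A^+$ and the corresponding gcd. We write $A_X^+$ for a parabolic submonoid and $A_X$ for the subgroup of $A$ it generates (a *parabolic subgroup*); one has $A_X^+=A_X\cap A^+$. The *positive ribbon category* $\mathcal R^+(A^+)$ has the parabolic submonoids as objects and the $g\in A^+$ with $g^{-1}A_X^+g=A_Y^+$ as morphisms $A_X^+\to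 A_Y^+$; composition is the product. Its *atoms* are the non-identity morphisms that are not products of two non-identity morphisms. The *ribbon groupoid* $\mathcal R(A)$ has the parabolic subgroups as objects and the $g\in A$ with $g^{-1}A_Xg=A_Y$ and $g^{-1}A_X^+g=A_Y^+$ as morphisms $A_X\to A_Y$. A *$\nu$-function* assigns to every $A_X^+$ and every $s\in S$ an atom $\nu_X(s)$ of $\mathcal R^+(A^+)$ with source $A_X^+$, such that (a) if $s$ left-divides a morphism $g$ of $\mathcal R^+(A^+)$ with source $A_X^+$, then $\nu_X(s)$ left-divides $g$, and (b) for all $s,t\in S$ the lcm of $\nu_X(s)$ and $\nu_X(t)$ for left-divisibility is a morphism of $\mathcal R^+(A^+)$ with source $A_X^+$. A *$\tilde\nu$-function* is defined in the same way with targets and right-divisibility in place of sources and left-divisibility. $A^+$ *has a $\nu$-structure* if it has a $\nu$-function and a $\tilde\nu$-function. Given a $\nu$-function, $\mathcal R^\nu(A)$ is the subgroupoid of $\mathcal R(A)$, with all parabolic subgroups as objects, generated by those $\nu_X(s)$ (for all $X$ and $s\in S$) that do not belong to $A_X^+$. A groupoid $\mathcal C$ is the *semi-direct product* $\mathcal D\rtimes\mathcal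 D'$ of subgroupoids $\mathcal D,\mathcal D'$ if every morphism of $\mathcal C$ is in a unique way a product $g_1g_2$ with $g_1$ in $\mathcal D$ and $g_2$ in $\mathcal D'$, all morphisms of $\mathcal D$ are endomorphisms, and $\mathcal D_{x\to x}\,g=g\,\mathcal D_{y\to y}$ for every $g\in\mathcal D'_{x\to y}$. A subcategory $\mathcal P$ of $\mathcal R^+(A^+)$ is *parabolic* if, for each of its objects $x$, the set $\mathcal P_{x\to\cdot}$ of its morphisms with source $x$ is closed under lcm's and gcd's for left-divisibility in $\mathcal R^+(A^+)_{x\to\cdot}$, the analogue holds for $\mathcal P_{\cdot\to x}$ and right-divisibility, and there are an automorphism $\varphi$ of $\mathcal P$ and a natural transformation $\delta$ from the inclusion $\iota_{\mathcal P}$ to $\iota_{\mathcal P}\circ\varphi$ such that, for every object $x$ of $\mathcal P$, the left-divisors of $\delta(x)$ are the left-divisors of $\Delta(x)$ lying in $\mathcal P_{x\to\cdot}$, and these are the gcd's $\Delta(x)\wedge p$ with $p\in\mathcal P_{x\to\cdot}$; here $\Delta(x)$ is the morphism with source $x$ given by $\Delta$. A *standard parabolic subgroupoid* of $\mathcal R(A)$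 is a subgroupoid generated by (the image of) such a $\mathcal P$. **Theorem.** Let $(A^+,\Delta)$ be a monoidal Garside structure such that $A^+$ has a $\nu$-structure, and let $A$ be its group of fractions. (i) Let $\mathcal{QZ}(A)$ be the totally disconnected groupoid whose objects are the parabolic subgroups of $A$ and whose vertex group at $A_X$ is the quasi-centralizer $\mathrm{QZ}(A_X)=\{g\in A_X : gA_X^+=A_X^+g\}$. Then $$\mathcal R(A)=\mathcal{QZ}(A)\rtimes\mathcal R^\nu(A).$$ (ii) Let $\mathrm{Conj}(A)$ be the groupoid whose objects are the parabolic subgroups of $A$, whose morphisms $A_X\to A_Y$ are the $g\in A$ with $g^{-1}A_Xg=A_Y$, and whose composition is the product in $A$; let $\mathcal P(A)$ be the totally disconnected groupoid whose objects are the parabolic subgroups and whose vertex group at $A_X$ is $A_X$. Then $$\mathrm{Conj}(A)=\mathcal P(A)\rtimes\mathcal R^\nu(A).$$ The vertex group of $\mathrm{Conj}(A)$ at $A_X$ is the normalizer of $A_X$ in $A$. Moreover, $\mathcal R^\nu(A)$ is a standard parabolic subgroupoid of $\mathcal R(A)$. -/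

import Mathlib

open CategoryTheory

universe u v

namespace GarsideRibbon

/-! ### Lcm's and gcd's for a divisibility relation -/

/-- `m` is a least common multiple of `a` and `b` for the (divisibility) relation `r`. -/
def IsLcm {α : Type*} (r : α → α → Prop) (a b m : α) : Prop :=
  r a m ∧ r b m ∧ ∀ n, r a n → r b n → r m n

/-- `d` is a greatest common divisor of `a` and `b` for the (divisibility) relation `r`. -/
def IsGcd {α : Type*} (r : α → α → Prop) (a b d : α) : Prop :=
  r d a ∧ r d b ∧ ∀ e, r e a → r e b → r e d

/-- Any two elements have a least common multiple and a greatest common divisor. -/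
def IsLattice {α : Type*} (r : α → α → Prop) : Prop :=
  ∀ a b, (∃ m, IsLcm r a b m) ∧ (∃ d, IsGcd r a b d)

/-- The subset `T` is a sublattice: lcm's and gcd's of elements of `T` (taken among all elements)
exist and lie in `T`. -/
def IsSublattice {α : Type*} (r : α → α → Prop) (T : Set α) : Prop :=
  ∀ a ∈ T, ∀ b ∈ T, (∃ m ∈ T, IsLcm r a b m) ∧ (∃ d ∈ T, IsGcd r a b d)

/-! ### Monoidal Garside structures -/

section Monoids

variable {M : Type u} [Monoid M]

/-- `a` left-divides `b`. -/
def LeftDvd (a b : M) : Prop := ∃ c, a * c = b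

/-- `a` right-divides `b`. -/
def RightDvd (a b : M) : Prop := ∃ c, c * a = b

/-- The atoms of the monoid `M`. -/
def IsMonoidAtom (s : M) : Prop := s ≠ 1 ∧ ∀ a b : M, a * b = s → a = 1 ∨ b = 1

variable (M) in
/-- The atom set `S` of the monoid `M`. -/
def Atoms : Type u := {s : M // IsMonoidAtom s}

/-- `(M, Δ)` is a monoidal Garside structure: a Garside category with a single object. -/
structure IsMonoidalGarside (Δ : M) : Prop where
  /-- `M` is cancellative. -/
  cancel : IsCancelMul M
  /-- `M` is noetherian: every infinite sequence in which each term is a factor of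
  the preceding one stabilizes. -/
  noetherian : ∀ w : ℕ → M, (∀ i, ∃ a b, w i = a * w (i + 1) * b) → ∃ N, ∀ i ≥ N, w i = w N
  lattice_left : IsLattice (LeftDvd (M := M))
  lattice_right : IsLattice (RightDvd (M := M))
  /-- `Δ` is a natural transformation from the identity to an automorphism `Φ`, and for every atom
  `v` there is `v'` with `v v' = Δ` and `v' Φ(v) = Δ`. -/
  exists_automorphism : ∃ Φ : M ≃* M, (∀ v, v * Δ = Δ * Φ v) ∧
    ∀ v, IsMonoidAtom v → ∃ v', v * v' = Δ ∧ v' * Φ v = Δ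

/-- Parabolic submonoids of `(M, Δ)`. -/
structure IsParabolicSubmonoid (Δ : M) (P : Submonoid M) : Prop where
  sublattice_left : IsSublattice LeftDvd (P : Set M)
  sublattice_right : IsSublattice RightDvd (P : Set M)
  /-- There is a morphism `δ : P → P` of the category of submonoids of `M` (that is, `δ ∈ M` such
  that `a δ = δ φ(a)` for an automorphism `φ` of `P`) with
  `[1, δ] = [1, Δ] ∩ P = Δ ∧ P`. -/
  exists_delta : ∃ δ : M, (∃ φ : P ≃* P, ∀ a : P, (a : M) * δ = δ * (φ a : M)) ∧
    {w | LeftDvd w δ} = {w | LeftDvd w Δ} ∩ (P : Set M) ∧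
    {w | LeftDvd w Δ} ∩ (P : Set M) = {w | ∃ p ∈ P, IsGcd LeftDvd Δ p w}

/-- The type of parabolic submonoids `A⁺_X` of `(M, Δ)`. -/
structure ParabolicSubmonoid (Δ : M) where
  carrier : Submonoid M
  isParabolic : IsParabolicSubmonoid Δ carrier

/-- Morphisms of the positive ribbon category: the elements `g` of `M` for which there is an
isomorphism `φ : P ≃ Q` with `a g = g φ(a)` for all `a` in `P`, that is `g⁻¹ P g = Q`. -/
@[ext]
structure PositiveRibbon {Δ : M} (P Q : ParabolicSubmonoid Δ) where
  elt : M
  exists_iso : ∃ φ : P.carrier ≃* Q.carrier, ∀ a : P.carrier, (a : M) * elt = elt * (φ a : M)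

/-- The positive ribbon category `R⁺(M)`. -/
instance positiveRibbonCategory (Δ : M) : Category (ParabolicSubmonoid Δ) where
  Hom P Q := PositiveRibbon P Q
  id P := ⟨1, MulEquiv.refl _, fun a => by simp⟩
  comp {P Q R} f g := ⟨f.elt * g.elt, by
    obtain ⟨φ, hφ⟩ := f.exists_iso
    obtain ⟨ψ, hψ⟩ := g.exists_iso
    refine ⟨φ.trans ψ, fun a => ?_⟩
    rw [← mul_assoc, hφ, mul_assoc, hψ, ← mul_assoc, MulEquiv.trans_apply]⟩
  id_comp f := PositiveRibbon.ext (one_mul f.elt)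
  comp_id f := PositiveRibbon.ext (mul_one f.elt)
  assoc f g h := PositiveRibbon.ext (mul_assoc f.elt g.elt h.elt)

/-- The element of `M` underlying a morphism of the positive ribbon category. -/
def ribbonElt {Δ : M} {X Y : ParabolicSubmonoid Δ} (f : X ⟶ Y) : M := PositiveRibbon.elt f

end Monoids

/-! ### Divisibility, atoms and parabolic subcategories in a small category -/

section Categories

variable {C : Type u} [Category.{v} C]

/-- The set of morphisms with source `x`. -/
abbrev Out (x : C) := Σ y : C, (x ⟶ y)

/-- The set of morphisms with target `x`. -/
abbrev In (x : C) := Σ y : C, (y ⟶ x)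

/-- Left-divisibility among the morphisms with source `x`. -/
def OutDvd {x : C} (f g : Out x) : Prop := ∃ k : f.1 ⟶ g.1, f.2 ≫ k = g.2

/-- Right-divisibility among the morphisms with target `x`. -/
def InDvd {x : C} (f g : In x) : Prop := ∃ k : g.1 ⟶ f.1, k ≫ f.2 = g.2

/-- `f` is an identity morphism. -/
def IsIdentity {x y : C} (f : x ⟶ y) : Prop := (⟨y, f⟩ : Out x) = ⟨x, 𝟙 x⟩

/-- The atoms of a category: the non-identity morphisms that are not the product of two
non-identity morphisms. -/
def IsCategoryAtom {x y : C} (f : x ⟶ y) : Prop :=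
  ¬ IsIdentity f ∧ ∀ (z : C) (g : x ⟶ z) (h : z ⟶ y), g ≫ h = f → IsIdentity g ∨ IsIdentity h

variable (C) in
/-- A subcategory of `C`, given by its morphisms; its objects are the objects whose identity
belongs to it. -/
structure Subcategory where
  arrows : ∀ x y : C, Set (x ⟶ y)
  id_source : ∀ {x y : C} {f : x ⟶ y}, f ∈ arrows x y → 𝟙 x ∈ arrows x x
  id_target : ∀ {x y : C} {f : x ⟶ y}, f ∈ arrows x y → 𝟙 y ∈ arrows y y
  comp : ∀ {x y z : C} {f : x ⟶ y} {g : y ⟶ z},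
    f ∈ arrows x y → g ∈ arrows y z → f ≫ g ∈ arrows x z

namespace Subcategory

variable (P : Subcategory C)

/-- The objects of a subcategory. -/
def Obj : Type u := {x : C // 𝟙 x ∈ P.arrows x x}

/-- A subcategory is itself a category. -/
instance category : Category.{v} P.Obj where
  Hom x y := {f : x.1 ⟶ y.1 // f ∈ P.arrows x.1 y.1}
  id x := ⟨𝟙 x.1, x.2⟩
  comp f g := ⟨f.1 ≫ g.1, P.comp f.2 g.2⟩
  id_comp f := Subtype.ext (Category.id_comp f.1)
  comp_id f := Subtype.ext (Category.comp_id f.1)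
  assoc f g h := Subtype.ext (Category.assoc f.1 g.1 h.1)

/-- The canonical functor from a subcategory to the category. -/
def incl : P.Obj ⥤ C where
  obj x := x.1
  map f := f.1

/-- The morphisms of `P` with source `x`. -/
def outSet (x : C) : Set (Out x) := {f | f.2 ∈ P.arrows x f.1}

/-- The morphisms of `P` with target `x`. -/
def inSet (x : C) : Set (In x) := {f | f.2 ∈ P.arrows f.1 x}

/-- Parabolic subcategories of a category `C` endowed with a distinguished morphism `Δ(x)` out of
each object `x`. The morphism `δ : P → P` of the category of subcategories of `C` is a natural
transformation from the inclusion `ι` of `P` to `φ ⋙ ι`, for an automorphism `φ` of `P`. -/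
structure IsParabolic (Δ : ∀ x : C, Out x) : Prop where
  sublattice_out : ∀ x : P.Obj, IsSublattice OutDvd (P.outSet x.1)
  sublattice_in : ∀ x : P.Obj, IsSublattice InDvd (P.inSet x.1)
  exists_delta : ∃ φ : P.Obj ⥤ P.Obj, (Function.Bijective φ.obj ∧ φ.Full ∧ φ.Faithful) ∧
    ∃ δ : P.incl ⟶ φ ⋙ P.incl, ∀ x : P.Obj,
      {f : Out x.1 | OutDvd f ⟨_, δ.app x⟩} = {f | OutDvd f (Δ x.1)} ∩ P.outSet x.1 ∧
      {f | OutDvd f (Δ x.1)} ∩ P.outSet x.1 =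
        {f | ∃ p ∈ P.outSet x.1, IsGcd OutDvd (Δ x.1) p f}

end Subcategory

end Categories

/-! ### Semi-direct products of groupoids -/

section Groupoids

variable {G : Type u} [Groupoid.{v} G]

/-- `C` is the (internal) Zappa-Szép product of its subgroupoids `D` and `D'`: every morphism of
`C` is in a unique way a product of a morphism of `D` and a morphism of `D'`. -/
structure IsZappaSzep (C D D' : Subgroupoid G) : Prop where
  left_le : D ≤ C
  right_le : D' ≤ C
  existsUnique : ∀ (x y : G), ∀ g ∈ C.arrows x y,
    ∃! p : Σ z : G, (x ⟶ z) × (z ⟶ y),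
      p.2.1 ∈ D.arrows x p.1 ∧ p.2.2 ∈ D'.arrows p.1 y ∧ p.2.1 ≫ p.2.2 = g

/-- `C = D ⋊ D'`: `C` is the Zappa-Szép product of `D` and `D'`, `D` is the union of its vertex
groups, and `D_x g = g D_y` for every morphism `g : x ⟶ y` of `D'`. -/
structure IsSemidirectProduct (C D D' : Subgroupoid G) : Prop where
  zappaSzep : IsZappaSzep C D D'
  totallyDisconnected : ∀ (x y : G), ∀ f ∈ D.arrows x y, x = y
  conj : ∀ (x y : G), ∀ g ∈ D'.arrows x y,
    (fun d : x ⟶ x => d ≫ g) '' D.arrows x x = (fun d : y ⟶ y => g ≫ d) '' D.arrows y y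

end Groupoids

/-! ### `ν`-structures -/

section Nu

variable {M : Type u} [Monoid M] {Δ : M}

/-- `ν` is a `ν`-function on `M`. -/
structure IsNuFunction (ν : ∀ X : ParabolicSubmonoid Δ, Atoms M → Out X) : Prop where
  atom : ∀ X s, IsCategoryAtom (ν X s).2
  dvd : ∀ X (s : Atoms M) (g : Out X), LeftDvd s.1 (ribbonElt g.2) → LeftDvd (ribbonElt (ν X s).2) (ribbonElt g.2)
  lcm : ∀ X s t, ∃ m : Out X, IsLcm LeftDvd (ribbonElt (ν X s).2) (ribbonElt (ν X t).2) (ribbonElt m.2)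

/-- `ν` is a `ν̃`-function on `M`. -/
structure IsNuTildeFunction (ν : ∀ X : ParabolicSubmonoid Δ, Atoms M → In X) : Prop where
  atom : ∀ X s, IsCategoryAtom (ν X s).2
  dvd : ∀ X (s : Atoms M) (g : In X), RightDvd s.1 (ribbonElt g.2) → RightDvd (ribbonElt (ν X s).2) (ribbonElt g.2)
  lcm : ∀ X s t, ∃ m : In X, IsLcm RightDvd (ribbonElt (ν X s).2) (ribbonElt (ν X t).2) (ribbonElt m.2)

end Nu

/-! ### The groupoids attached to a Garside group -/

section Group

variable {M : Type u} [Monoid M] {A : Type v} [Group A]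

/-- `A`, with `ι : M → A`, is the group of fractions of `M`. -/
structure IsGroupOfFractions (ι : M →* A) : Prop where
  injective : Function.Injective ι
  exists_fraction : ∀ g : A, ∃ a b : M, g = ι a * (ι b)⁻¹

/-- The (standard) parabolic subgroup `A_X` associated with a parabolic submonoid `A⁺_X`: the
subgroup it generates. -/
def subgroupOf (ι : M →* A) {Δ : M} (X : ParabolicSubmonoid Δ) : Subgroup A :=
  Subgroup.closure (ι '' (X.carrier : Set M))

/-- The type of (standard) parabolic subgroups of `A`. -/
structure ParabolicSubgroup (ι : M →* A) (Δ : M) where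
  carrier : Subgroup A
  exists_submonoid : ∃ X : ParabolicSubmonoid Δ, carrier = subgroupOf ι X

/-- The parabolic subgroup `A_X`, as an object. -/
def ParabolicSubmonoid.toSubgroup (ι : M →* A) {Δ : M} (X : ParabolicSubmonoid Δ) :
    ParabolicSubgroup ι Δ := ⟨subgroupOf ι X, X, rfl⟩

/-- The set `g⁻¹ T g`. -/
def conjSet (g : A) (T : Set A) : Set A := (fun a => g⁻¹ * a * g) '' T

theorem conjSet_one (T : Set A) : conjSet 1 T = T := by simp [conjSet]

theorem conjSet_mul (g h : A) (T : Set A) : conjSet (g * h) T = conjSet h (conjSet g T) := by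
  simp [conjSet, Set.image_image, mul_assoc]

theorem conjSet_inv {g : A} {T U : Set A} (h : conjSet g T = U) : conjSet g⁻¹ U = T := by
  rw [← h, ← conjSet_mul, mul_inv_cancel, conjSet_one]

variable {ι : M →* A} {Δ : M}

/-- Morphisms of `Conj(A)`: the `g` in `A` with `g⁻¹ A_X g = A_Y`. -/
@[ext]
structure Conjugator (H K : ParabolicSubgroup ι Δ) where
  elt : A
  conj_eq : conjSet elt (H.carrier : Set A) = K.carrier

variable (ι Δ) in
/-- The groupoid `Conj(A)` on the set of parabolic subgroups of `A`; the composition is the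
product in `A`. -/
instance conjGroupoid : Groupoid (ParabolicSubgroup ι Δ) where
  Hom H K := Conjugator H K
  id H := ⟨1, conjSet_one _⟩
  comp f g := ⟨f.elt * g.elt, by rw [conjSet_mul, f.conj_eq, g.conj_eq]⟩
  id_comp f := Conjugator.ext (one_mul f.elt)
  comp_id f := Conjugator.ext (mul_one f.elt)
  assoc f g h := Conjugator.ext (mul_assoc f.elt g.elt h.elt)
  inv f := ⟨f.elt⁻¹, conjSet_inv f.conj_eq⟩
  inv_comp f := Conjugator.ext (inv_mul_cancel f.elt)
  comp_inv f := Conjugator.ext (mul_inv_cancel f.elt)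

/-- The element of `A` underlying a morphism of `Conj(A)`. -/
def conjElt {H K : ParabolicSubgroup ι Δ} (f : H ⟶ K) : A := Conjugator.elt f

/-- The positive part `A⁺_X = A_X ∩ A⁺` of a parabolic subgroup `A_X`. -/
def ParabolicSubgroup.pos (H : ParabolicSubgroup ι Δ) : Set A :=
  {a | a ∈ H.carrier ∧ a ∈ Set.range ι}

variable (ι Δ) in
/-- The ribbon groupoid `R(A)`: its morphisms from `A_X` to `A_Y` are the `g` in `A` with
`g⁻¹ A_X g = A_Y` and `g⁻¹ A⁺_X g = A⁺_Y`. -/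
def ribbonGroupoid : Subgroupoid (ParabolicSubgroup ι Δ) where
  arrows H K := {f | conjSet (conjElt f) H.pos = K.pos}
  inv hp := conjSet_inv hp
  mul {c d e p} hp {q} hq := by
    change conjSet (conjElt p * conjElt q) _ = _
    rw [conjSet_mul, hp, hq]

variable (ι Δ) in
/-- The totally disconnected groupoid `P(A)`, with vertex group `A_X` at `A_X`. -/
def parabolicGroupoid : Subgroupoid (ParabolicSubgroup ι Δ) where
  arrows H K := {f | H = K ∧ conjElt f ∈ H.carrier}
  inv {c d p} hp := by
    obtain ⟨rfl, hp⟩ := hp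
    exact ⟨rfl, c.carrier.inv_mem hp⟩
  mul {c d e p} hp {q} hq := by
    obtain ⟨rfl, hp⟩ := hp
    obtain ⟨rfl, hq⟩ := hq
    exact ⟨rfl, c.carrier.mul_mem hp hq⟩

/-- The quasi-centralizer `QZ(A_X)`: the `g` in `A_X` with `g A⁺_X = A⁺_X g`. -/
def quasiCentralizer (H : ParabolicSubgroup ι Δ) : Subgroup A where
  carrier := {g | g ∈ H.carrier ∧ (fun a => g * a) '' H.pos = (fun a => a * g) '' H.pos}
  one_mem' := ⟨H.carrier.one_mem, by simp⟩
  mul_mem' := by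
    rintro g h ⟨hg, hg'⟩ ⟨hh, hh'⟩
    refine ⟨H.carrier.mul_mem hg hh, ?_⟩
    have h1 : (fun a => g * h * a) '' H.pos = (fun a => g * a) '' ((fun a => h * a) '' H.pos) := by
      rw [Set.image_image]
      simp only [mul_assoc]
    have h2 : (fun a => a * (g * h)) '' H.pos =
        (fun a => a * h) '' ((fun a => a * g) '' H.pos) := by
      rw [Set.image_image]
      simp only [mul_assoc]
    rw [h1, h2, hh', ← hg', Set.image_image, Set.image_image]
    simp only [mul_assoc]
  inv_mem' := by
    rintro g ⟨hg, hg'⟩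
    refine ⟨H.carrier.inv_mem hg, ?_⟩
    have h3 := congrArg (fun T : Set A => (fun a => g⁻¹ * a * g⁻¹) '' T) hg'
    simp only [Set.image_image] at h3
    simpa only [mul_assoc, inv_mul_cancel_left, mul_inv_cancel, mul_one] using h3.symm

variable (ι Δ) in
/-- The totally disconnected groupoid `QZ(A)`, with vertex group `QZ(A_X)` at `A_X`. -/
def quasiCentralizerGroupoid : Subgroupoid (ParabolicSubgroup ι Δ) where
  arrows H K := {f | H = K ∧ conjElt f ∈ quasiCentralizer H}
  inv {c d p} hp := by
    obtain ⟨rfl, hp⟩ := hp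
    exact ⟨rfl, (quasiCentralizer c).inv_mem hp⟩
  mul {c d e p} hp {q} hq := by
    obtain ⟨rfl, hp⟩ := hp
    obtain ⟨rfl, hq⟩ := hq
    exact ⟨rfl, (quasiCentralizer c).mul_mem hp hq⟩

/-- The edges `ν(X, s)`: the morphisms of `Conj(A)` from `A_X` to `A_Y` given by those `ν_X(s)`,
from `A⁺_X` to `A⁺_Y`, that do not belong to `A⁺_X`. -/
def nuEdges (ι : M →* A) (ν : ∀ X : ParabolicSubmonoid Δ, Atoms M → Out X)
    (H K : ParabolicSubgroup ι Δ) : Set (H ⟶ K) :=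
  {f | ∃ (X : ParabolicSubmonoid Δ) (s : Atoms M), X.toSubgroup ι = H ∧
    (ν X s).1.toSubgroup ι = K ∧ ribbonElt (ν X s).2 ∉ X.carrier ∧
    conjElt f = ι (ribbonElt (ν X s).2)}

/-- The groupoid `R^ν(A)` generated by the `ν(X, s)`, with all parabolic subgroups as objects
(the subgroupoid `discrete` consists of all the identity morphisms). -/
def nuGroupoid (ι : M →* A) (ν : ∀ X : ParabolicSubmonoid Δ, Atoms M → Out X) :
    Subgroupoid (ParabolicSubgroup ι Δ) :=
  Subgroupoid.generated (nuEdges ι ν) ⊔ Subgroupoid.discrete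

/-- The morphisms of `Conj(A)` that are images of positive ribbons belonging to `P`. -/
def imageEdges (ι : M →* A) (P : Subcategory (ParabolicSubmonoid Δ))
    (H K : ParabolicSubgroup ι Δ) : Set (H ⟶ K) :=
  {f | ∃ (X Y : ParabolicSubmonoid Δ) (g : X ⟶ Y), g ∈ P.arrows X Y ∧ X.toSubgroup ι = H ∧
    Y.toSubgroup ι = K ∧ conjElt f = ι (ribbonElt g)}

/-- `S` is a standard parabolic subgroupoid of `R(A)`: it is the groupoid of fractions of (the
subgroupoid generated by) a parabolic subcategory of the positive ribbon category, the latter being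
endowed with the natural transformation whose value `Δ(X)` at each object `X` is the morphism out
of `X` given by the element `Δ`. -/
def IsStandardParabolicSubgroupoid (S : Subgroupoid (ParabolicSubgroup ι Δ)) : Prop :=
  ∃ D : ∀ X : ParabolicSubmonoid Δ, Out X, (∀ X, ribbonElt (D X).2 = Δ) ∧
    ∃ P : Subcategory (ParabolicSubmonoid Δ), P.IsParabolic D ∧
      S = Subgroupoid.generated (imageEdges ι P)

end Group

end GarsideRibbon

/-! Call a ribbon from `X` to `Y` reduced if no non-trivial element of `A⁺_X` left-divides it. The
theorem says that `R^ν(A)` is the groupoid of fractions of the reduced positive ribbons.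

Existence in (ii): a conjugator becomes positive after multiplication by a power of `Δ`. A positive
conjugator `g` is stripped of its left factors in `A⁺_X` and its right factors in `A⁺_Y`, giving `g
= p r q`. Comparing fractions shows that the core `r` is a reduced ribbon
(`exists_isReducedRibbon_of_conjSet`), and `p`, `q` are absorbed into `A_X`.

Uniqueness: lcm's of reduced ribbons are reduced ribbons, so an element of `R^ν(A)` is a single
fraction `a b⁻¹` of reduced ribbons. If it lies in `A_X`, then `p a = q b` with `p, q` in `A⁺_X`,
and reducedness forces `a = b` (`IsReduced.mul_eq_mul`).

The `ν`-structure enters twice. It makes ribbons closed under gcd's and, by duality in a power of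
`Δ`, under lcm's. It also identifies the reduced ribbons with the products of the `ν_X(s)` outside
`A⁺_X` (`IsNuFunction.mem_nuGroupoid`, `IsNuFunction.isReducedRibbon_of_isCategoryAtom`).

Part (i) is (ii) intersected with `R(A)`. For parabolicity, the Garside morphism at `X` is the
reduced part `r` of `Δ = δ r`, where `δ` is the Garside element of `A⁺_X`. -/

namespace GarsideRibbon

/-! ### Left- and right-divisibility in a monoid -/

section Divisibility

variable {M : Type u} [Monoid M]

theorem LeftDvd.refl (a : M) : LeftDvd a a := ⟨1, mul_one a⟩

theorem RightDvd.refl (a : M) : RightDvd a a := ⟨1, one_mul a⟩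

theorem LeftDvd.trans {a b c : M} (h : LeftDvd a b) (h' : LeftDvd b c) : LeftDvd a c := by
  obtain ⟨x, rfl⟩ := h
  obtain ⟨y, rfl⟩ := h'
  exact ⟨x * y, (mul_assoc _ _ _).symm⟩

theorem RightDvd.trans {a b c : M} (h : RightDvd a b) (h' : RightDvd b c) : RightDvd a c := by
  obtain ⟨x, rfl⟩ := h
  obtain ⟨y, rfl⟩ := h'
  exact ⟨y * x, mul_assoc _ _ _⟩

theorem leftDvd_mul (a b : M) : LeftDvd a (a * b) := ⟨b, rfl⟩

theorem rightDvd_mul (a b : M) : RightDvd b (a * b) := ⟨a, rfl⟩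

theorem LeftDvd.mul_left {a b : M} (h : LeftDvd a b) (c : M) : LeftDvd (c * a) (c * b) := by
  obtain ⟨x, rfl⟩ := h
  exact ⟨x, mul_assoc _ _ _⟩

theorem RightDvd.mul_right {a b : M} (h : RightDvd a b) (c : M) : RightDvd (a * c) (b * c) := by
  obtain ⟨x, rfl⟩ := h
  exact ⟨x, (mul_assoc _ _ _).symm⟩

theorem LeftDvd.of_mul_left [IsCancelMul M] {a b c : M} (h : LeftDvd (c * a) (c * b)) :
    LeftDvd a b := by
  obtain ⟨x, hx⟩ := h
  exact ⟨x, mul_left_cancel (by rw [← mul_assoc, hx])⟩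

theorem RightDvd.of_mul_right [IsCancelMul M] {a b c : M} (h : RightDvd (a * c) (b * c)) :
    RightDvd a b := by
  obtain ⟨x, hx⟩ := h
  exact ⟨x, mul_right_cancel (by rw [mul_assoc, hx])⟩

end Divisibility

/-! ### Noetherian induction, atoms and powers of `Δ` -/

namespace IsMonoidalGarside

variable {M : Type u} [Monoid M] {Δ : M}

/-- Being a proper factor is a well-founded relation. -/
theorem wellFounded_factor (hΔ : IsMonoidalGarside Δ) :
    WellFounded (fun b a : M => (∃ x y, a = x * b * y) ∧ b ≠ a) := by
  rw [wellFounded_iff_isEmpty_descending_chain]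
  refine ⟨fun ⟨w, hw⟩ => ?_⟩
  obtain ⟨N, hN⟩ := hΔ.noetherian w fun i => (hw i).1
  exact (hw N).2 (hN (N + 1) (Nat.le_succ N))

theorem eq_one_of_mul (hΔ : IsMonoidalGarside Δ) {a b : M} (h : a * b = 1) : a = 1 ∧ b = 1 := by
  have ha : a = 1 := by
    -- Since `a * b = 1`, each of `1` and `a` is a factor of the other, so the alternating sequence
    -- `1, a, 1, a, …` must stabilize.
    obtain ⟨N, hN⟩ := hΔ.noetherian (fun i => if Even i then 1 else a) fun i => by
      by_cases hi : Even i
      · exact ⟨1, b, by simp [hi, Nat.even_add_one, h]⟩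
      · exact ⟨a, 1, by simp [hi, Nat.even_add_one]⟩
    have h1 := hN (2 * N + 1) (by omega)
    have h2 := hN (2 * N) (by omega)
    simp only [even_two, Even.mul_right, if_true, Nat.even_add_one, not_true, if_false] at h1 h2
    exact h1.trans h2.symm
  subst ha
  exact ⟨rfl, by simpa using h⟩

theorem leftDvd_antisymm (hΔ : IsMonoidalGarside Δ) {a b : M} (h : LeftDvd a b)
    (h' : LeftDvd b a) : a = b := by
  have := hΔ.cancel
  obtain ⟨x, rfl⟩ := h
  obtain ⟨y, hy⟩ := h'
  rw [mul_assoc, mul_eq_left] at hy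
  rw [(hΔ.eq_one_of_mul hy).1, mul_one]

theorem rightDvd_antisymm (hΔ : IsMonoidalGarside Δ) {a b : M} (h : RightDvd a b)
    (h' : RightDvd b a) : a = b := by
  have := hΔ.cancel
  obtain ⟨x, rfl⟩ := h
  obtain ⟨y, hy⟩ := h'
  rw [← mul_assoc, mul_eq_right] at hy
  rw [(hΔ.eq_one_of_mul hy).2, one_mul]

/-- Induction along proper right factors. -/
theorem induction_right_factor (hΔ : IsMonoidalGarside Δ) {p : M → Prop}
    (h : ∀ g, (∀ s g', s ≠ 1 → s * g' = g → p g') → p g) (g : M) : p g := by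
  have := hΔ.cancel
  induction g using hΔ.wellFounded_factor.induction with
  | _ g ih =>
    refine h g fun s g' hs hg => ih g' ⟨⟨s, 1, by rw [mul_one, hg]⟩, fun he => hs ?_⟩
    rwa [he, mul_eq_right] at hg

/-- Induction along proper left factors. -/
theorem induction_left_factor (hΔ : IsMonoidalGarside Δ) {p : M → Prop}
    (h : ∀ g, (∀ s g', s ≠ 1 → g' * s = g → p g') → p g) (g : M) : p g := by
  have := hΔ.cancel
  induction g using hΔ.wellFounded_factor.induction with
  | _ g ih =>
    refine h g fun s g' hs hg => ih g' ⟨⟨1, s, by rw [one_mul, hg]⟩, fun he => hs ?_⟩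
    rwa [he, mul_eq_left] at hg

theorem exists_atom_leftDvd (hΔ : IsMonoidalGarside Δ) (g : M) (hg : g ≠ 1) :
    ∃ s, IsMonoidAtom s ∧ LeftDvd s g := by
  induction g using hΔ.induction_left_factor with
  | _ g ih =>
    by_cases h : IsMonoidAtom g
    · exact ⟨g, h, .refl g⟩
    · simp only [IsMonoidAtom, hg, not_forall, ne_eq, not_false_eq_true, true_and,
        not_or] at h
      obtain ⟨a, b, hab, ha, hb⟩ := h
      obtain ⟨s, hs, hsa⟩ := ih b a hb hab ha
      exact ⟨s, hs, hsa.trans ⟨b, hab⟩⟩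

theorem exists_atom_rightDvd (hΔ : IsMonoidalGarside Δ) (g : M) (hg : g ≠ 1) :
    ∃ s, IsMonoidAtom s ∧ RightDvd s g := by
  induction g using hΔ.induction_right_factor with
  | _ g ih =>
    by_cases h : IsMonoidAtom g
    · exact ⟨g, h, .refl g⟩
    · simp only [IsMonoidAtom, hg, not_forall, ne_eq, not_false_eq_true, true_and,
        not_or] at h
      obtain ⟨a, b, hab, ha, hb⟩ := h
      obtain ⟨s, hs, hsb⟩ := ih a b ha hab hb
      exact ⟨s, hs, hsb.trans ⟨a, hab⟩⟩

theorem atom_leftDvd (hΔ : IsMonoidalGarside Δ) {s : M} (hs : IsMonoidAtom s) : LeftDvd s Δ := by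
  obtain ⟨Φ, -, hΦ⟩ := hΔ.exists_automorphism
  obtain ⟨v, hv, -⟩ := hΦ s hs
  exact ⟨v, hv⟩

/-- Conjugation by a power of `Δ` is an automorphism that fixes `Δ`. -/
theorem exists_automorphism_pow (hΔ : IsMonoidalGarside Δ) (n : ℕ) :
    ∃ Ψ : M ≃* M, Ψ Δ = Δ ∧ ∀ v, v * Δ ^ n = Δ ^ n * Ψ v := by
  have := hΔ.cancel
  obtain ⟨Φ, hΦ, -⟩ := hΔ.exists_automorphism
  have hfix : Φ Δ = Δ := (mul_left_cancel (hΦ Δ)).symm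
  induction n with
  | zero => exact ⟨.refl M, rfl, by simp⟩
  | succ n ih =>
    obtain ⟨Ψ, hΨ, h⟩ := ih
    refine ⟨Ψ.trans Φ, by simp [hΨ, hfix], fun v => ?_⟩
    rw [pow_succ, ← mul_assoc, h, mul_assoc, hΦ, ← mul_assoc, MulEquiv.trans_apply]

theorem isMonoidAtom_map {s : M} (hs : IsMonoidAtom s) (Ψ : M ≃* M) : IsMonoidAtom (Ψ s) := by
  refine ⟨by simpa using hs.1, fun a b hab => ?_⟩
  have := hs.2 (Ψ.symm a) (Ψ.symm b) (by rw [← map_mul, hab, Ψ.symm_apply_apply])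
  simpa using this

/-- Each atom split off `g` costs one more `Δ`: moved past `Δ ^ n` it is still an atom, hence still
divides `Δ`. This is what lets denominators in `A` be powers of `Δ`. -/
theorem exists_leftDvd_pow (hΔ : IsMonoidalGarside Δ) (g : M) : ∃ n : ℕ, LeftDvd g (Δ ^ n) := by
  induction g using hΔ.induction_right_factor with
  | _ g ih =>
    by_cases hg : g = 1
    · exact ⟨0, 1, by simp [hg]⟩
    obtain ⟨s, hs, g', hg'⟩ := hΔ.exists_atom_leftDvd g hg
    obtain ⟨n, c, hc⟩ := ih s g' hs.1 hg'
    obtain ⟨Ψ, -, hΨ⟩ := hΔ.exists_automorphism_pow n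
    obtain ⟨v, hv⟩ := hΔ.atom_leftDvd (isMonoidAtom_map hs Ψ)
    exact ⟨n + 1, c * v, by
      rw [← hg', mul_assoc, ← mul_assoc g', hc, ← mul_assoc, hΨ, mul_assoc, hv, pow_succ]⟩

theorem exists_rightDvd_pow (hΔ : IsMonoidalGarside Δ) (g : M) : ∃ n : ℕ, RightDvd g (Δ ^ n) := by
  have := hΔ.cancel
  obtain ⟨n, c, hc⟩ := hΔ.exists_leftDvd_pow g
  obtain ⟨Ψ, hΨ, h⟩ := hΔ.exists_automorphism_pow n
  -- From `g c = Δⁿ` and `g Δⁿ = Δⁿ Ψ(g)`, cancelling `g` gives `c Ψ(g) = Δⁿ`.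
  refine ⟨n, Ψ.symm c, Ψ.injective ?_⟩
  rw [map_mul, Ψ.apply_symm_apply, map_pow, hΨ]
  refine mul_left_cancel (a := g) ?_
  rw [← mul_assoc, hc, h]

theorem leftDvd_pow_of_le {g : M} {m n : ℕ} (h : LeftDvd g (Δ ^ m)) (hmn : m ≤ n) :
    LeftDvd g (Δ ^ n) :=
  h.trans ⟨Δ ^ (n - m), by rw [← pow_add, Nat.add_sub_cancel' hmn]⟩

theorem rightDvd_pow_of_le {g : M} {m n : ℕ} (h : RightDvd g (Δ ^ m)) (hmn : m ≤ n) :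
    RightDvd g (Δ ^ n) :=
  h.trans ⟨Δ ^ (n - m), by rw [← pow_add, Nat.sub_add_cancel hmn]⟩

end IsMonoidalGarside

/-! ### Parabolic submonoids: Garside element and closure under factors -/

namespace ParabolicSubmonoid

variable {M : Type u} [Monoid M] {Δ : M}

theorem lcm_left_mem (X : ParabolicSubmonoid Δ) (hΔ : IsMonoidalGarside Δ) {a b m : M}
    (ha : a ∈ X.carrier) (hb : b ∈ X.carrier) (h : IsLcm LeftDvd a b m) : m ∈ X.carrier := by
  obtain ⟨⟨m', hm', h'⟩, -⟩ := X.isParabolic.sublattice_left a ha b hb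
  rwa [hΔ.leftDvd_antisymm (h.2.2 m' h'.1 h'.2.1) (h'.2.2 m h.1 h.2.1)]

theorem lcm_right_mem (X : ParabolicSubmonoid Δ) (hΔ : IsMonoidalGarside Δ) {a b m : M}
    (ha : a ∈ X.carrier) (hb : b ∈ X.carrier) (h : IsLcm RightDvd a b m) : m ∈ X.carrier := by
  obtain ⟨⟨m', hm', h'⟩, -⟩ := X.isParabolic.sublattice_right a ha b hb
  rwa [hΔ.rightDvd_antisymm (h.2.2 m' h'.1 h'.2.1) (h'.2.2 m h.1 h.2.1)]

/-- A parabolic submonoid has a Garside element `δ`, whose divisors are the divisors of `Δ` in the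
submonoid; it is divisible by every divisor of `Δ` that divides an element of the submonoid. -/
theorem exists_garside (X : ParabolicSubmonoid Δ) (hΔ : IsMonoidalGarside Δ) :
    ∃ δ ∈ X.carrier, (∃ φ : X.carrier ≃* X.carrier, ∀ a : X.carrier, (a : M) * δ = δ * (φ a : M)) ∧
      (∀ w, LeftDvd w δ ↔ LeftDvd w Δ ∧ w ∈ X.carrier) ∧
      ∀ w, LeftDvd w Δ → ∀ p ∈ X.carrier, LeftDvd w p → LeftDvd w δ := by
  obtain ⟨δ, hφ, h1, h2⟩ := X.isParabolic.exists_delta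
  have h1' : ∀ w, LeftDvd w δ ↔ LeftDvd w Δ ∧ w ∈ X.carrier := fun w => Set.ext_iff.1 h1 w
  refine ⟨δ, ((h1' δ).1 (.refl δ)).2, hφ, h1', fun w hw p hp hwp => ?_⟩
  obtain ⟨-, d, hd⟩ := hΔ.lattice_left Δ p
  have : d ∈ {w | LeftDvd w Δ} ∩ (X.carrier : Set M) := h2 ▸ ⟨p, hp, hd⟩
  exact (hd.2.2 w hw hwp).trans ((h1' d).2 this)

/-- A parabolic submonoid is closed under factors. -/
theorem mem_of_mul_mem (X : ParabolicSubmonoid Δ) (hΔ : IsMonoidalGarside Δ) {a b : M}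
    (h : a * b ∈ X.carrier) : a ∈ X.carrier ∧ b ∈ X.carrier := by
  have := hΔ.cancel
  obtain ⟨δ, hδ, ⟨φ, hφ⟩, h1, h2⟩ := X.exists_garside hΔ
  -- With `s t = δ`, moving elements of `X` past `δ` gives `t φ(s) = δ`, so `t` is in `X`, and `p δ
  -- = t φ(s p)`.
  have key : ∀ s p, LeftDvd s δ → s * p ∈ X.carrier → p * δ ∈ X.carrier := by
    rintro s p ⟨t, ht⟩ hsp
    have hs : s ∈ X.carrier := ((h1 s).1 ⟨t, ht⟩).2
    have ht' : t * φ ⟨s, hs⟩ = δ := mul_left_cancel (a := s) <| by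
      rw [← mul_assoc, ht, ← hφ]
    have htX : t ∈ X.carrier := ((h1 t).1 ⟨_, ht'⟩).2
    have : p * δ = t * φ ⟨s * p, hsp⟩ := mul_left_cancel (a := s) <| by
      rw [← mul_assoc, ← mul_assoc, ht, ← hφ]
    rw [this]
    exact X.carrier.mul_mem htX (φ _).2
  have atom_dvd : ∀ s p q, IsMonoidAtom s → s * p * q ∈ X.carrier → LeftDvd s δ :=
    fun s p q hs hp => h2 s (hΔ.atom_leftDvd hs) _ hp ⟨p * q, (mul_assoc _ _ _).symm⟩
  -- An atom dividing an element of `X` divides `δ`, so it can be removed by `key` at the price of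
  -- one extra `δ`; hence the arbitrary exponent.
  have key2 : ∀ p, ∀ n : ℕ, p * δ ^ n ∈ X.carrier → p ∈ X.carrier := by
    intro p
    induction p using hΔ.induction_right_factor with
    | _ p ih =>
      intro n hn
      by_cases hp : p = 1
      · exact hp ▸ X.carrier.one_mem
      obtain ⟨s, hs, p', rfl⟩ := hΔ.exists_atom_leftDvd p hp
      have hsδ := atom_dvd s p' _ hs hn
      rw [mul_assoc] at hn
      have := key s _ hsδ hn
      rw [mul_assoc, ← pow_succ] at this
      exact X.carrier.mul_mem ((h1 s).1 hsδ).2 (ih s p' hs.1 rfl _ this)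
  induction a using hΔ.induction_right_factor with
  | _ a ih =>
    by_cases ha : a = 1
    · subst ha
      exact ⟨X.carrier.one_mem, by simpa using h⟩
    obtain ⟨s, hs, a', rfl⟩ := hΔ.exists_atom_leftDvd a ha
    have hsδ := atom_dvd s a' b hs h
    rw [mul_assoc] at h
    have h3 := key2 (a' * b) 1 (by simpa using key s _ hsδ h)
    have h4 := ih s a' hs.1 rfl h3
    exact ⟨X.carrier.mul_mem ((h1 s).1 hsδ).2 h4.1, h4.2⟩

theorem mem_of_leftDvd (X : ParabolicSubmonoid Δ) (hΔ : IsMonoidalGarside Δ) {a b : M}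
    (h : LeftDvd a b) (hb : b ∈ X.carrier) : a ∈ X.carrier := by
  obtain ⟨c, rfl⟩ := h
  exact (X.mem_of_mul_mem hΔ hb).1

theorem ext_carrier {X Y : ParabolicSubmonoid Δ} (h : X.carrier = Y.carrier) : X = Y := by
  cases X; cases Y; congr

end ParabolicSubmonoid

/-! ### Ribbons as elements of the monoid -/

section Ribbons

variable {M : Type u} [Monoid M] {Δ : M}

/-- `P g = g Q`. -/
def IsRibbon (P Q : Submonoid M) (g : M) : Prop :=
  (∀ a ∈ P, ∃ b ∈ Q, a * g = g * b) ∧ ∀ b ∈ Q, ∃ a ∈ P, a * g = g * b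

theorem ribbonElt_isRibbon {X Y : ParabolicSubmonoid Δ} (f : X ⟶ Y) :
    IsRibbon X.carrier Y.carrier (ribbonElt f) := by
  obtain ⟨φ, hφ⟩ := PositiveRibbon.exists_iso f
  exact ⟨fun a ha => ⟨φ ⟨a, ha⟩, (φ _).2, hφ ⟨a, ha⟩⟩,
    fun b hb => ⟨φ.symm ⟨b, hb⟩, (φ.symm _).2, by
      simpa [ribbonElt] using hφ (φ.symm ⟨b, hb⟩)⟩⟩

theorem IsRibbon.exists_equiv [IsCancelMul M] {P Q : Submonoid M} {g : M} (h : IsRibbon P Q g) :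
    ∃ φ : P ≃* Q, ∀ a : P, (a : M) * g = g * (φ a : M) := by
  choose f hf hf' using h.1
  refine ⟨MulEquiv.ofBijective (⟨⟨fun a => ⟨f a a.2, hf a a.2⟩, ?_⟩, ?_⟩ : P →* Q) ⟨?_, ?_⟩,
    fun a => hf' a a.2⟩
  · refine Subtype.ext (mul_left_cancel (a := g) ?_)
    simp [← hf']
  · intro a b
    refine Subtype.ext (mul_left_cancel (a := g) ?_)
    change g * f (a * b : M) _ = g * (f a _ * f b _)
    rw [← hf', mul_assoc, hf' b b.2, ← mul_assoc, hf' a a.2, mul_assoc]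
  · intro a b hab
    have hab' : f a a.2 = f b b.2 := congrArg Subtype.val hab
    refine Subtype.ext (mul_right_cancel (b := g) ?_)
    rw [hf' a a.2, hab', ← hf']
  · rintro ⟨b, hb⟩
    obtain ⟨a, ha, hab⟩ := h.2 b hb
    exact ⟨⟨a, ha⟩, Subtype.ext (mul_left_cancel (a := g) (by rw [← hab]; exact (hf' a ha).symm))⟩

theorem IsRibbon.exists_hom [IsCancelMul M] {X Y : ParabolicSubmonoid Δ} {g : M}
    (h : IsRibbon X.carrier Y.carrier g) : ∃ f : X ⟶ Y, ribbonElt f = g :=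
  ⟨(⟨g, h.exists_equiv⟩ : PositiveRibbon X Y), rfl⟩

theorem IsRibbon.of_equiv {P Q : Submonoid M} {g : M} (φ : P ≃* Q)
    (hφ : ∀ a : P, (a : M) * g = g * (φ a : M)) : IsRibbon P Q g :=
  ⟨fun a ha => ⟨φ ⟨a, ha⟩, (φ _).2, hφ ⟨a, ha⟩⟩,
    fun b hb => ⟨φ.symm ⟨b, hb⟩, (φ.symm _).2, by simpa using hφ (φ.symm ⟨b, hb⟩)⟩⟩

theorem IsRibbon.one (P : Submonoid M) : IsRibbon P P 1 := by simp [IsRibbon]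

theorem IsRibbon.mul {P Q R : Submonoid M} {g h : M} (hg : IsRibbon P Q g) (hh : IsRibbon Q R h) :
    IsRibbon P R (g * h) := by
  constructor
  · intro a ha
    obtain ⟨b, hb, hab⟩ := hg.1 a ha
    obtain ⟨c, hc, hbc⟩ := hh.1 b hb
    exact ⟨c, hc, by rw [← mul_assoc, hab, mul_assoc, hbc, mul_assoc]⟩
  · intro c hc
    obtain ⟨b, hb, hbc⟩ := hh.2 c hc
    obtain ⟨a, ha, hab⟩ := hg.2 b hb
    exact ⟨a, ha, by rw [← mul_assoc, hab, mul_assoc, hbc, mul_assoc]⟩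

theorem IsRibbon.of_mul_left [IsCancelMul M] {P Q R : Submonoid M} {g h : M}
    (hg : IsRibbon P Q g) (hgh : IsRibbon P R (g * h)) : IsRibbon Q R h := by
  constructor
  · intro b hb
    obtain ⟨a, ha, hab⟩ := hg.2 b hb
    obtain ⟨c, hc, hac⟩ := hgh.1 a ha
    exact ⟨c, hc, mul_left_cancel (a := g) (by rw [← mul_assoc, ← hab, mul_assoc, hac, mul_assoc])⟩
  · intro c hc
    obtain ⟨a, ha, hac⟩ := hgh.2 c hc
    obtain ⟨b, hb, hab⟩ := hg.1 a ha
    exact ⟨b, hb, mul_left_cancel (a := g) (by rw [← mul_assoc, ← hab, mul_assoc, hac, mul_assoc])⟩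

theorem IsRibbon.of_mul_right [IsCancelMul M] {P Q R : Submonoid M} {g h : M}
    (hh : IsRibbon Q R h) (hgh : IsRibbon P R (g * h)) : IsRibbon P Q g := by
  constructor
  · intro a ha
    obtain ⟨c, hc, hac⟩ := hgh.1 a ha
    obtain ⟨b, hb, hbc⟩ := hh.2 c hc
    exact ⟨b, hb, mul_right_cancel (b := h) (by rw [mul_assoc, hac, mul_assoc, ← hbc, mul_assoc])⟩
  · intro b hb
    obtain ⟨c, hc, hbc⟩ := hh.1 b hb
    obtain ⟨a, ha, hac⟩ := hgh.2 c hc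
    exact ⟨a, ha, mul_right_cancel (b := h) (by rw [mul_assoc, hac, mul_assoc, ← hbc, mul_assoc])⟩

theorem IsRibbon.target_unique [IsCancelMul M] {P Q Q' : Submonoid M} {g : M}
    (h : IsRibbon P Q g) (h' : IsRibbon P Q' g) : Q = Q' := by
  have key : ∀ {Q Q' : Submonoid M}, IsRibbon P Q g → IsRibbon P Q' g → Q ≤ Q' := by
    intro Q Q' h h' b hb
    obtain ⟨a, ha, hab⟩ := h.2 b hb
    obtain ⟨b', hb', hab'⟩ := h'.1 a ha
    rwa [mul_left_cancel (hab.symm.trans hab')]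
  exact le_antisymm (key h h') (key h' h)

/-- By cancellation the source and the element determine the target, so morphisms out of `X` can be
treated as elements of `M`. -/
theorem out_ext [IsCancelMul M] {X : ParabolicSubmonoid Δ} {f g : Out X}
    (h : ribbonElt f.2 = ribbonElt g.2) : f = g := by
  obtain ⟨Y, f⟩ := f
  obtain ⟨Z, g⟩ := g
  obtain rfl : Y = Z := ParabolicSubmonoid.ext_carrier
    ((ribbonElt_isRibbon f).target_unique (by
      rw [show ribbonElt f = ribbonElt g from h]
      exact ribbonElt_isRibbon g))
  congr
  exact PositiveRibbon.ext h

theorem isIdentity_iff [IsCancelMul M] {X Y : ParabolicSubmonoid Δ} (f : X ⟶ Y) :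
    IsIdentity f ↔ ribbonElt f = 1 := by
  refine ⟨fun h => ?_, fun h => out_ext (g := ⟨X, 𝟙 X⟩) h⟩
  exact congrArg (fun g : Out X => ribbonElt g.2) h

/-- The quotient of two ribbons with a common source is automatically a ribbon. -/
theorem outDvd_iff [IsCancelMul M] {X : ParabolicSubmonoid Δ} (f g : Out X) :
    OutDvd f g ↔ LeftDvd (ribbonElt f.2) (ribbonElt g.2) := by
  constructor
  · rintro ⟨k, hk⟩
    exact ⟨ribbonElt k, congrArg ribbonElt hk⟩
  · rintro ⟨c, hc⟩
    obtain ⟨k, rfl⟩ := ((ribbonElt_isRibbon f.2).of_mul_left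
      (hc ▸ ribbonElt_isRibbon g.2)).exists_hom
    exact ⟨k, PositiveRibbon.ext hc⟩

theorem inDvd_iff [IsCancelMul M] {X : ParabolicSubmonoid Δ} (f g : In X) :
    InDvd f g ↔ RightDvd (ribbonElt f.2) (ribbonElt g.2) := by
  constructor
  · rintro ⟨k, hk⟩
    exact ⟨ribbonElt k, congrArg ribbonElt hk⟩
  · rintro ⟨c, hc⟩
    obtain ⟨k, rfl⟩ := ((ribbonElt_isRibbon f.2).of_mul_right
      (hc ▸ ribbonElt_isRibbon g.2)).exists_hom
    exact ⟨k, PositiveRibbon.ext hc⟩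

end Ribbons

/-! ### Transport along automorphisms fixing `Δ` -/

section Transport

variable {M : Type u} [Monoid M]

theorem leftDvd_map_iff (Ψ : M ≃* M) {a b : M} : LeftDvd (Ψ a) (Ψ b) ↔ LeftDvd a b := by
  constructor
  · rintro ⟨c, hc⟩
    exact ⟨Ψ.symm c, Ψ.injective (by simp [hc])⟩
  · rintro ⟨c, rfl⟩
    exact ⟨Ψ c, by simp⟩

theorem rightDvd_map_iff (Ψ : M ≃* M) {a b : M} : RightDvd (Ψ a) (Ψ b) ↔ RightDvd a b := by
  constructor
  · rintro ⟨c, hc⟩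
    exact ⟨Ψ.symm c, Ψ.injective (by simp [hc])⟩
  · rintro ⟨c, rfl⟩
    exact ⟨Ψ c, by simp⟩

theorem isLcm_map_iff (Ψ : M ≃* M) {r : M → M → Prop} (hr : ∀ {a b}, r (Ψ a) (Ψ b) ↔ r a b)
    {a b m : M} : IsLcm r (Ψ a) (Ψ b) (Ψ m) ↔ IsLcm r a b m := by
  exact and_congr hr (and_congr hr (Ψ.surjective.forall.trans (by simp only [hr])))

theorem isGcd_map_iff (Ψ : M ≃* M) {r : M → M → Prop} (hr : ∀ {a b}, r (Ψ a) (Ψ b) ↔ r a b)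
    {a b m : M} : IsGcd r (Ψ a) (Ψ b) (Ψ m) ↔ IsGcd r a b m := by
  exact and_congr hr (and_congr hr (Ψ.surjective.forall.trans (by simp only [hr])))

theorem IsSublattice.map {r : M → M → Prop} {T : Submonoid M} (h : IsSublattice r (T : Set M))
    (Ψ : M ≃* M) (hr : ∀ {a b}, r (Ψ a) (Ψ b) ↔ r a b) :
    IsSublattice r (T.map Ψ : Set M) := by
  rintro _ ⟨a, ha, rfl⟩ _ ⟨b, hb, rfl⟩
  obtain ⟨⟨m, hm, hm'⟩, d, hd, hd'⟩ := h a ha b hb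
  exact ⟨⟨Ψ m, ⟨m, hm, rfl⟩, (isLcm_map_iff Ψ hr).2 hm'⟩,
    Ψ d, ⟨d, hd, rfl⟩, (isGcd_map_iff Ψ hr).2 hd'⟩

variable {Δ : M}

/-- The image of a parabolic submonoid under an automorphism that fixes `Δ`. -/
def ParabolicSubmonoid.map (X : ParabolicSubmonoid Δ) (Ψ : M ≃* M) (hΨ : Ψ Δ = Δ) :
    ParabolicSubmonoid Δ where
  carrier := X.carrier.map Ψ
  isParabolic := by
    obtain ⟨δ, ⟨φ, hφ⟩, h1, h2⟩ := X.isParabolic.exists_delta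
    have hsymm : Ψ.symm Δ = Δ := by rw [MulEquiv.symm_apply_eq, hΨ]
    have hdvd : ∀ a b : M, LeftDvd (Ψ a) b ↔ LeftDvd a (Ψ.symm b) := fun a b => by
      rw [← leftDvd_map_iff Ψ (a := a), Ψ.apply_symm_apply]
    refine ⟨X.isParabolic.sublattice_left.map Ψ (leftDvd_map_iff Ψ),
      X.isParabolic.sublattice_right.map Ψ (rightDvd_map_iff Ψ), Ψ δ, ?_, ?_, ?_⟩
    · refine ⟨((Ψ.submonoidMap X.carrier).symm.trans φ).trans (Ψ.submonoidMap X.carrier), ?_⟩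
      rintro ⟨_, a, ha, rfl⟩
      have : (Ψ.submonoidMap X.carrier).symm ⟨Ψ a, a, ha, rfl⟩ = ⟨a, ha⟩ := by
        rw [MulEquiv.symm_apply_eq]; rfl
      have h := congrArg Ψ (hφ ⟨a, ha⟩)
      rw [map_mul, map_mul] at h
      rw [MulEquiv.trans_apply, MulEquiv.trans_apply]
      erw [this]
      exact h
    · ext w
      obtain ⟨w, rfl⟩ := Ψ.surjective w
      have := Set.ext_iff.1 h1 w
      simpa [hdvd, hsymm] using this
    · ext w
      obtain ⟨w, rfl⟩ := Ψ.surjective w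
      have := Set.ext_iff.1 h2 w
      have hg : ∀ p, IsGcd LeftDvd Δ (Ψ p) (Ψ w) ↔ IsGcd LeftDvd Δ p w := fun p => by
        conv_lhs => rw [← hΨ]
        exact isGcd_map_iff Ψ (leftDvd_map_iff Ψ)
      simpa [hdvd, hsymm, hg] using this

theorem ParabolicSubmonoid.isRibbon_map (X : ParabolicSubmonoid Δ) {Ψ : M ≃* M} (hΨ : Ψ Δ = Δ)
    {g : M} (hg : ∀ v, v * g = g * Ψ v) : IsRibbon X.carrier (X.map Ψ hΨ).carrier g :=
  ⟨fun a ha => ⟨Ψ a, ⟨a, ha, rfl⟩, hg a⟩, by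
    rintro _ ⟨a, ha, rfl⟩
    exact ⟨a, ha, hg a⟩⟩

theorem IsRibbon.map {X Y : ParabolicSubmonoid Δ} {g : M} (h : IsRibbon X.carrier Y.carrier g)
    (Ψ : M ≃* M) (hΨ : Ψ Δ = Δ) : IsRibbon (X.map Ψ hΨ).carrier (Y.map Ψ hΨ).carrier (Ψ g) := by
  constructor
  · rintro _ ⟨a, ha, rfl⟩
    obtain ⟨b, hb, hab⟩ := h.1 a ha
    exact ⟨Ψ b, ⟨b, hb, rfl⟩, by simpa using congrArg Ψ hab⟩
  · rintro _ ⟨b, hb, rfl⟩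
    obtain ⟨a, ha, hab⟩ := h.2 b hb
    exact ⟨Ψ a, ⟨a, ha, rfl⟩, by simpa using congrArg Ψ hab⟩

theorem ParabolicSubmonoid.map_map_symm (X : ParabolicSubmonoid Δ) (Ψ : M ≃* M) (hΨ : Ψ Δ = Δ)
    (hΨ' : Ψ.symm Δ = Δ) : (X.map Ψ.symm hΨ').map Ψ hΨ = X := by
  refine ParabolicSubmonoid.ext_carrier ?_
  change (X.carrier.map Ψ.symm).map Ψ = X.carrier
  ext; simp

theorem ParabolicSubmonoid.map_injective (Ψ : M ≃* M) (hΨ : Ψ Δ = Δ) :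
    Function.Injective (fun X : ParabolicSubmonoid Δ => X.map Ψ hΨ) := fun _ _ h =>
  ParabolicSubmonoid.ext_carrier <| Submonoid.map_injective_of_injective (f := Ψ)
    Ψ.injective (congrArg ParabolicSubmonoid.carrier h)

end Transport

/-! ### Closure of ribbons under gcd's and lcm's -/

section Lattice

variable {M : Type u} [Monoid M] {Δ : M}

/-- If an atom `s` divides `d`, then `ν_X(s)` divides both `g` and `h`, hence `d`; cancel it and
induct. -/
theorem IsNuFunction.isRibbon_gcd {ν : ∀ X : ParabolicSubmonoid Δ, Atoms M → Out X}
    (hν : IsNuFunction ν) (hΔ : IsMonoidalGarside Δ) {X Y Z : ParabolicSubmonoid Δ} {g h d : M}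
    (hg : IsRibbon X.carrier Y.carrier g) (hh : IsRibbon X.carrier Z.carrier h)
    (hd : IsGcd LeftDvd g h d) : ∃ W : ParabolicSubmonoid Δ, IsRibbon X.carrier W.carrier d := by
  have := hΔ.cancel
  induction d using hΔ.induction_right_factor generalizing X g h with
  | _ d ih =>
    by_cases hd1 : d = 1
    · exact ⟨X, hd1 ▸ .one _⟩
    obtain ⟨s, hs, hsd⟩ := hΔ.exists_atom_leftDvd d hd1
    obtain ⟨fg, rfl⟩ := hg.exists_hom
    obtain ⟨fh, rfl⟩ := hh.exists_hom
    obtain ⟨g', hg'⟩ := hν.dvd X ⟨s, hs⟩ ⟨Y, fg⟩ (hsd.trans hd.1)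
    obtain ⟨h', hh'⟩ := hν.dvd X ⟨s, hs⟩ ⟨Z, fh⟩ (hsd.trans hd.2.1)
    have hz1 := (isIdentity_iff _).not.1 (hν.atom X ⟨s, hs⟩).1
    have hzr := ribbonElt_isRibbon (ν X ⟨s, hs⟩).2
    set z := ribbonElt (ν X ⟨s, hs⟩).2
    simp only at hg' hh'
    obtain ⟨d', hd'⟩ := hd.2.2 z ⟨g', hg'⟩ ⟨h', hh'⟩
    rw [← hg', ← hh', ← hd'] at hd
    obtain ⟨W, hW⟩ := ih z d' hz1 hd' (hzr.of_mul_left (hg' ▸ hg)) (hzr.of_mul_left (hh' ▸ hh))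
      ⟨hd.1.of_mul_left, hd.2.1.of_mul_left, fun e he he' =>
        (hd.2.2 _ (he.mul_left z) (he'.mul_left z)).of_mul_left⟩
    exact ⟨W, hd' ▸ hzr.mul hW⟩

theorem IsNuTildeFunction.isRibbon_gcd {ν : ∀ X : ParabolicSubmonoid Δ, Atoms M → In X}
    (hν : IsNuTildeFunction ν) (hΔ : IsMonoidalGarside Δ) {X Y Z : ParabolicSubmonoid Δ} {g h d : M}
    (hg : IsRibbon Y.carrier X.carrier g) (hh : IsRibbon Z.carrier X.carrier h)
    (hd : IsGcd RightDvd g h d) : ∃ W : ParabolicSubmonoid Δ, IsRibbon W.carrier X.carrier d := by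
  have := hΔ.cancel
  induction d using hΔ.induction_left_factor generalizing X g h with
  | _ d ih =>
    by_cases hd1 : d = 1
    · exact ⟨X, hd1 ▸ .one _⟩
    obtain ⟨s, hs, hsd⟩ := hΔ.exists_atom_rightDvd d hd1
    obtain ⟨fg, rfl⟩ := hg.exists_hom
    obtain ⟨fh, rfl⟩ := hh.exists_hom
    obtain ⟨g', hg'⟩ := hν.dvd X ⟨s, hs⟩ ⟨Y, fg⟩ (hsd.trans hd.1)
    obtain ⟨h', hh'⟩ := hν.dvd X ⟨s, hs⟩ ⟨Z, fh⟩ (hsd.trans hd.2.1)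
    have hz1 : ribbonElt (ν X ⟨s, hs⟩).2 ≠ 1 := (isIdentity_iff _).not.1 (hν.atom X ⟨s, hs⟩).1
    have hzr := ribbonElt_isRibbon (ν X ⟨s, hs⟩).2
    set z := ribbonElt (ν X ⟨s, hs⟩).2
    simp only at hg' hh'
    obtain ⟨d', hd'⟩ := hd.2.2 z ⟨g', hg'⟩ ⟨h', hh'⟩
    rw [← hg', ← hh', ← hd'] at hd
    obtain ⟨W, hW⟩ := ih z d' hz1 hd' (hzr.of_mul_right (hg' ▸ hg)) (hzr.of_mul_right (hh' ▸ hh))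
      ⟨hd.1.of_mul_right, hd.2.1.of_mul_right, fun e he he' =>
        (hd.2.2 _ (he.mul_right z) (he'.mul_right z)).of_mul_right⟩
    exact ⟨W, hd' ▸ hW.mul hzr⟩

/-- The lcm of two left-divisors of `D` is complementary to the right-gcd of their complements. -/
theorem IsMonoidalGarside.exists_complement_lcm_left (hΔ : IsMonoidalGarside Δ) {g h m g' h' D : M}
    (hm : IsLcm LeftDvd g h m) (hg' : g * g' = D) (hh' : h * h' = D) :
    ∃ k, m * k = D ∧ IsGcd RightDvd g' h' k := by
  have := hΔ.cancel
  obtain ⟨k, hk⟩ := hm.2.2 D ⟨g', hg'⟩ ⟨h', hh'⟩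
  refine ⟨k, hk, ?_, ?_, ?_⟩
  · obtain ⟨x, rfl⟩ := hm.1
    exact ⟨x, mul_left_cancel (a := g) (by rw [hg', ← hk, mul_assoc])⟩
  · obtain ⟨x, rfl⟩ := hm.2.1
    exact ⟨x, mul_left_cancel (a := h) (by rw [hh', ← hk, mul_assoc])⟩
  · rintro e ⟨x, rfl⟩ ⟨y, rfl⟩
    have hxy : g * x = h * y := mul_right_cancel (b := e) (by
      rw [mul_assoc, mul_assoc, hg', hh'])
    obtain ⟨c, hc⟩ := hm.2.2 (g * x) ⟨x, rfl⟩ ⟨y, hxy.symm⟩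
    exact ⟨c, mul_left_cancel (a := m) (by rw [← mul_assoc, hc, mul_assoc, hg', hk])⟩

theorem IsMonoidalGarside.exists_complement_lcm_right (hΔ : IsMonoidalGarside Δ)
    {g h m g' h' D : M} (hm : IsLcm RightDvd g h m) (hg' : g' * g = D) (hh' : h' * h = D) :
    ∃ k, k * m = D ∧ IsGcd LeftDvd g' h' k := by
  have := hΔ.cancel
  obtain ⟨k, hk⟩ := hm.2.2 D ⟨g', hg'⟩ ⟨h', hh'⟩
  refine ⟨k, hk, ?_, ?_, ?_⟩
  · obtain ⟨x, rfl⟩ := hm.1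
    exact ⟨x, mul_right_cancel (b := g) (by rw [hg', ← hk, mul_assoc])⟩
  · obtain ⟨x, rfl⟩ := hm.2.1
    exact ⟨x, mul_right_cancel (b := h) (by rw [hh', ← hk, mul_assoc])⟩
  · rintro e ⟨x, rfl⟩ ⟨y, rfl⟩
    have hxy : x * g = y * h := mul_left_cancel (a := e) (by
      rw [← mul_assoc, ← mul_assoc, hg', hh'])
    obtain ⟨c, hc⟩ := hm.2.2 (x * g) ⟨x, rfl⟩ ⟨y, hxy.symm⟩
    exact ⟨c, mul_right_cancel (b := m) (by rw [mul_assoc, hc, ← mul_assoc, hg', hk])⟩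

/-- Complements in a power of `Δ`, itself a ribbon out of `X`, turn left lcm's into right gcd's.
This is why left lcm's are governed by the `ν̃`-function. -/
theorem IsNuTildeFunction.isRibbon_lcm {ν : ∀ X : ParabolicSubmonoid Δ, Atoms M → In X}
    (hν : IsNuTildeFunction ν) (hΔ : IsMonoidalGarside Δ) {X Y Z : ParabolicSubmonoid Δ} {g h m : M}
    (hg : IsRibbon X.carrier Y.carrier g) (hh : IsRibbon X.carrier Z.carrier h)
    (hm : IsLcm LeftDvd g h m) : ∃ W : ParabolicSubmonoid Δ, IsRibbon X.carrier W.carrier m := by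
  have := hΔ.cancel
  obtain ⟨n₁, h₁⟩ := hΔ.exists_leftDvd_pow g
  obtain ⟨n₂, h₂⟩ := hΔ.exists_leftDvd_pow h
  obtain ⟨g', hg'⟩ := IsMonoidalGarside.leftDvd_pow_of_le h₁ (le_max_left n₁ n₂)
  obtain ⟨h', hh'⟩ := IsMonoidalGarside.leftDvd_pow_of_le h₂ (le_max_right n₁ n₂)
  obtain ⟨Ψ, hΨ, hc⟩ := hΔ.exists_automorphism_pow (max n₁ n₂)
  have hD := X.isRibbon_map hΨ hc
  obtain ⟨k, hk, hgcd⟩ := hΔ.exists_complement_lcm_left hm hg' hh'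
  obtain ⟨W, hW⟩ := hν.isRibbon_gcd hΔ (hg.of_mul_left (hg' ▸ hD)) (hh.of_mul_left (hh' ▸ hD)) hgcd
  exact ⟨W, hW.of_mul_right (hk ▸ hD)⟩

theorem IsNuFunction.isRibbon_lcm {ν : ∀ X : ParabolicSubmonoid Δ, Atoms M → Out X}
    (hν : IsNuFunction ν) (hΔ : IsMonoidalGarside Δ) {X Y Z : ParabolicSubmonoid Δ} {g h m : M}
    (hg : IsRibbon Y.carrier X.carrier g) (hh : IsRibbon Z.carrier X.carrier h)
    (hm : IsLcm RightDvd g h m) : ∃ W : ParabolicSubmonoid Δ, IsRibbon W.carrier X.carrier m := by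
  have := hΔ.cancel
  obtain ⟨n₁, h₁⟩ := hΔ.exists_rightDvd_pow g
  obtain ⟨n₂, h₂⟩ := hΔ.exists_rightDvd_pow h
  obtain ⟨g', hg'⟩ := IsMonoidalGarside.rightDvd_pow_of_le h₁ (le_max_left n₁ n₂)
  obtain ⟨h', hh'⟩ := IsMonoidalGarside.rightDvd_pow_of_le h₂ (le_max_right n₁ n₂)
  obtain ⟨Ψ, hΨ, hc⟩ := hΔ.exists_automorphism_pow (max n₁ n₂)
  have hΨ' : Ψ.symm Δ = Δ := by rw [MulEquiv.symm_apply_eq, hΨ]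
  -- The source is `Ψ⁻¹(X)`, so that the power of `Δ` is a ribbon with target `X`.
  have hD := (X.map Ψ.symm hΨ').isRibbon_map hΨ hc
  rw [X.map_map_symm Ψ hΨ hΨ'] at hD
  obtain ⟨k, hk, hgcd⟩ := hΔ.exists_complement_lcm_right hm hg' hh'
  obtain ⟨W, hW⟩ := hν.isRibbon_gcd hΔ (hg.of_mul_right (hg' ▸ hD)) (hh.of_mul_right (hh' ▸ hD))
    hgcd
  exact ⟨W, hW.of_mul_left (hk ▸ hD)⟩

end Lattice

/-! ### Reduced elements and reduced ribbons -/

section Reduced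

variable {M : Type u} [Monoid M] {Δ : M}

/-- No non-trivial element of `P` left-divides `g`. -/
def IsReduced (P : Submonoid M) (g : M) : Prop := ∀ a ∈ P, LeftDvd a g → a = 1

/-- No non-trivial element of `P` right-divides `g`. -/
def IsRightReduced (P : Submonoid M) (g : M) : Prop := ∀ a ∈ P, RightDvd a g → a = 1

theorem IsReduced.of_leftDvd {P : Submonoid M} {g h : M} (hg : IsReduced P g) (h' : LeftDvd h g) :
    IsReduced P h := fun a ha hah => hg a ha (hah.trans h')

theorem IsRightReduced.of_rightDvd {P : Submonoid M} {g h : M} (hg : IsRightReduced P g)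
    (h' : RightDvd h g) : IsRightReduced P h := fun a ha hah => hg a ha (hah.trans h')

theorem IsMonoidalGarside.isReduced_one (hΔ : IsMonoidalGarside Δ) (P : Submonoid M) :
    IsReduced P 1 := fun _ _ ⟨_, hc⟩ => (hΔ.eq_one_of_mul hc).1

theorem IsMonoidalGarside.exists_mul_isReduced (hΔ : IsMonoidalGarside Δ) (P : Submonoid M)
    (g : M) : ∃ p ∈ P, ∃ g', IsReduced P g' ∧ p * g' = g := by
  induction g using hΔ.induction_right_factor with
  | _ g ih =>
    by_cases hg : IsReduced P g
    · exact ⟨1, P.one_mem, g, hg, one_mul g⟩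
    · simp only [IsReduced, not_forall] at hg
      obtain ⟨a, ha, ⟨g', hg'⟩, ha1⟩ := hg
      obtain ⟨p, hp, k, hk, rfl⟩ := ih a g' ha1 hg'
      exact ⟨a * p, P.mul_mem ha hp, k, hk, by rw [mul_assoc, hg']⟩

theorem IsMonoidalGarside.exists_isRightReduced_mul (hΔ : IsMonoidalGarside Δ) (P : Submonoid M)
    (g : M) : ∃ p ∈ P, ∃ g', IsRightReduced P g' ∧ g' * p = g := by
  induction g using hΔ.induction_left_factor with
  | _ g ih =>
    by_cases hg : IsRightReduced P g
    · exact ⟨1, P.one_mem, g, hg, mul_one g⟩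
    · simp only [IsRightReduced, not_forall] at hg
      obtain ⟨a, ha, ⟨g', hg'⟩, ha1⟩ := hg
      obtain ⟨p, hp, k, hk, rfl⟩ := ih a g' ha1 hg'
      exact ⟨p * a, P.mul_mem hp ha, k, hk, by rw [← mul_assoc, hg']⟩

/-- The lcm of `p` and `a` lies in `X` and divides `p g`. Its quotient by `p` lies in `X` and
divides `g`, so it is trivial. -/
theorem IsReduced.leftDvd_of_mul {X : ParabolicSubmonoid Δ} {g a p : M}
    (hg : IsReduced X.carrier g) (hΔ : IsMonoidalGarside Δ) (ha : a ∈ X.carrier)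
    (hp : p ∈ X.carrier) (h : LeftDvd a (p * g)) : LeftDvd a p := by
  have := hΔ.cancel
  obtain ⟨⟨m, hm⟩, -⟩ := hΔ.lattice_left p a
  have hmX := X.lcm_left_mem hΔ hp ha hm
  have hm2 := hm.2.2 _ (leftDvd_mul p g) h
  obtain ⟨p', rfl⟩ := hm.1
  have hp' := hg p' (X.mem_of_mul_mem hΔ hmX).2 hm2.of_mul_left
  simpa [hp'] using hm.2.1

theorem IsRightReduced.rightDvd_of_mul {X : ParabolicSubmonoid Δ} {g a p : M}
    (hg : IsRightReduced X.carrier g) (hΔ : IsMonoidalGarside Δ) (ha : a ∈ X.carrier)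
    (hp : p ∈ X.carrier) (h : RightDvd a (g * p)) : RightDvd a p := by
  have := hΔ.cancel
  obtain ⟨⟨m, hm⟩, -⟩ := hΔ.lattice_right p a
  have hmX := X.lcm_right_mem hΔ hp ha hm
  have hm2 := hm.2.2 _ (rightDvd_mul g p) h
  obtain ⟨p', rfl⟩ := hm.1
  have hp' := hg p' (X.mem_of_mul_mem hΔ hmX).1 hm2.of_mul_right
  simpa [hp'] using hm.2.1

/-- `p` and `q` divide each other by `IsReduced.leftDvd_of_mul`. All uniqueness in the theorem comes
from here. -/
theorem IsReduced.mul_eq_mul {X : ParabolicSubmonoid Δ} {g h p q : M}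
    (hg : IsReduced X.carrier g) (hh : IsReduced X.carrier h) (hΔ : IsMonoidalGarside Δ)
    (hp : p ∈ X.carrier) (hq : q ∈ X.carrier) (e : p * g = q * h) : p = q ∧ g = h := by
  have := hΔ.cancel
  have hpq : p = q := hΔ.leftDvd_antisymm (hh.leftDvd_of_mul hΔ hp hq ⟨g, e⟩)
    (hg.leftDvd_of_mul hΔ hq hp ⟨h, e.symm⟩)
  subst hpq
  exact ⟨rfl, mul_left_cancel e⟩

/-- Write `s g = g t`. The lcm is `g u` with `u` dividing `t`, so `u` is in `Y` and `g u = a g` with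
`a` in `X` dividing `s`. Reducedness turns `s ≼ a g` into `s ≼ a`, whence `a = s`. -/
theorem IsRibbon.isLcm_left {X Y : ParabolicSubmonoid Δ} {g s : M}
    (hg : IsRibbon X.carrier Y.carrier g) (hr : IsReduced X.carrier g) (hΔ : IsMonoidalGarside Δ)
    (hs : s ∈ X.carrier) : IsLcm LeftDvd s g (s * g) := by
  have := hΔ.cancel
  obtain ⟨t, ht, hst⟩ := hg.1 s hs
  obtain ⟨⟨m, hm⟩, -⟩ := hΔ.lattice_left s g
  have h1 := hm.2.2 _ (leftDvd_mul s g) ⟨t, hst.symm⟩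
  obtain ⟨u, rfl⟩ := hm.2.1
  obtain ⟨v, rfl⟩ : LeftDvd u t := (hst ▸ h1).of_mul_left
  obtain ⟨hu, hv⟩ := Y.mem_of_mul_mem hΔ ht
  obtain ⟨a, ha, hau⟩ := hg.2 u hu
  obtain ⟨b, hb, hbv⟩ := hg.2 v hv
  have hab : s = a * b := mul_right_cancel (b := g) (by
    rw [hst, mul_assoc, hbv, ← mul_assoc, ← mul_assoc, hau])
  have hsa : LeftDvd s a := hr.leftDvd_of_mul hΔ hs ha (hau ▸ hm.1)
  rw [hΔ.leftDvd_antisymm hsa ⟨b, hab.symm⟩, hau]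
  rwa [← hΔ.leftDvd_antisymm hsa ⟨b, hab.symm⟩]

theorem IsRibbon.isLcm_right {X Y : ParabolicSubmonoid Δ} {g t : M}
    (hg : IsRibbon X.carrier Y.carrier g) (hr : IsRightReduced Y.carrier g)
    (hΔ : IsMonoidalGarside Δ) (ht : t ∈ Y.carrier) : IsLcm RightDvd t g (g * t) := by
  have := hΔ.cancel
  obtain ⟨s, hs, hst⟩ := hg.2 t ht
  obtain ⟨⟨m, hm⟩, -⟩ := hΔ.lattice_right t g
  have h1 := hm.2.2 _ (rightDvd_mul g t) ⟨s, hst⟩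
  obtain ⟨u, rfl⟩ := hm.2.1
  obtain ⟨v, rfl⟩ : RightDvd u s := (hst ▸ h1).of_mul_right
  obtain ⟨hv, hu⟩ := X.mem_of_mul_mem hΔ hs
  obtain ⟨a, ha, hau⟩ := hg.1 u hu
  obtain ⟨b, hb, hbv⟩ := hg.1 v hv
  have hab : t = b * a := mul_left_cancel (a := g) (by
    rw [← hst, mul_assoc, hau, ← mul_assoc, ← mul_assoc, hbv])
  have hsa : RightDvd t a := hr.rightDvd_of_mul hΔ ht ha (hau ▸ hm.1)
  rw [hΔ.rightDvd_antisymm hsa ⟨b, hab.symm⟩, ← hau]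
  rwa [← hΔ.rightDvd_antisymm hsa ⟨b, hab.symm⟩]

/-- If `g = g' t` and `s g = g t`, cancelling `t` gives `s g' = g`; so a right factor in `Y`
produces a left factor in `X`, and conversely. -/
theorem IsRibbon.isReduced_iff {X Y : ParabolicSubmonoid Δ} {g : M}
    (hg : IsRibbon X.carrier Y.carrier g) (hΔ : IsMonoidalGarside Δ) :
    IsReduced X.carrier g ↔ IsRightReduced Y.carrier g := by
  have := hΔ.cancel
  constructor
  · rintro hr t ht ⟨g', hg'⟩
    obtain ⟨s, hs, hst⟩ := hg.2 t ht
    have h1 : s * g' = g := by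
      refine mul_right_cancel (b := t) ?_
      rw [mul_assoc, hg', hst]
    have hs1 := hr s hs ⟨g', h1⟩
    rw [hs1, one_mul] at h1
    rwa [h1, mul_eq_left] at hg'
  · rintro hr s hs ⟨g', hg'⟩
    obtain ⟨t, ht, hst⟩ := hg.1 s hs
    have h1 : g' * t = g := by
      refine mul_left_cancel (a := s) ?_
      rw [← mul_assoc, hg', hst]
    have ht1 := hr t ht ⟨g', h1⟩
    rw [ht1, mul_one] at h1
    rwa [h1, mul_eq_right] at hg'

/-- Ribbons `g` from `P` to `Q` such that no non-trivial element of `P` divides `g`. -/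
def IsReducedRibbon (P Q : Submonoid M) (g : M) : Prop := IsRibbon P Q g ∧ IsReduced P g

theorem IsReducedRibbon.one (hΔ : IsMonoidalGarside Δ) (P : Submonoid M) :
    IsReducedRibbon P P 1 := ⟨.one P, hΔ.isReduced_one P⟩

/-- An `s` in `X` dividing `g h` has lcm `s g = g t` with `g`, which then divides `g h`; so `t`
divides `h` and is trivial. -/
theorem IsReducedRibbon.mul {X Y Z : ParabolicSubmonoid Δ} {g h : M}
    (hg : IsReducedRibbon X.carrier Y.carrier g) (hh : IsReducedRibbon Y.carrier Z.carrier h)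
    (hΔ : IsMonoidalGarside Δ) : IsReducedRibbon X.carrier Z.carrier (g * h) := by
  have := hΔ.cancel
  refine ⟨hg.1.mul hh.1, fun s hs hsgh => ?_⟩
  obtain ⟨t, ht, hst⟩ := hg.1.1 s hs
  have h1 := (hg.1.isLcm_left hg.2 hΔ hs).2.2 _ hsgh (leftDvd_mul g h)
  have ht1 : t = 1 := hh.2 t ht (hst ▸ h1).of_mul_left
  rwa [ht1, mul_one, mul_eq_right] at hst

theorem IsReducedRibbon.of_mul_left {X Y Z : ParabolicSubmonoid Δ} {g h : M}
    (hg : IsRibbon X.carrier Y.carrier g) (hgh : IsReducedRibbon X.carrier Z.carrier (g * h))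
    (hΔ : IsMonoidalGarside Δ) : IsReducedRibbon Y.carrier Z.carrier h := by
  have := hΔ.cancel
  refine ⟨hg.of_mul_left hgh.1, fun t ht hth => ?_⟩
  obtain ⟨s, hs, hst⟩ := hg.2 t ht
  have hs1 := hgh.2 s hs (LeftDvd.trans ⟨g, rfl⟩ (hst ▸ hth.mul_left g))
  rwa [hs1, one_mul, eq_comm, mul_eq_left] at hst

theorem IsMonoidalGarside.eq_one_of_mul_mul_eq (hΔ : IsMonoidalGarside Δ) {a m c : M}
    (h : a * m * c = m) : a = 1 ∧ c = 1 := by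
  have := hΔ.cancel
  have h1 : m * c = m := by
    -- Otherwise `m` and `m c` would be proper factors of each other.
    by_contra hne
    exact hΔ.wellFounded_factor.asymmetric (a := m) (b := m * c)
      ⟨⟨1, c, by rw [one_mul]⟩, Ne.symm hne⟩ ⟨⟨a, 1, by rw [mul_one, ← mul_assoc, h]⟩, hne⟩
  rw [mul_assoc, h1, mul_eq_right] at h
  exact ⟨h, mul_eq_left.1 h1⟩

/-- If `m = a m'` with `a` in `X`, then `a g` and `a h` divide `m`, so `g` and `h` divide `m'`.
Hence `m` divides `m'`, which forces `a = 1`. -/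
theorem IsReducedRibbon.isReduced_lcm {X Y Z : ParabolicSubmonoid Δ} {g h m : M}
    (hg : IsReducedRibbon X.carrier Y.carrier g) (hh : IsReducedRibbon X.carrier Z.carrier h)
    (hΔ : IsMonoidalGarside Δ) (hm : IsLcm LeftDvd g h m) : IsReduced X.carrier m := by
  have := hΔ.cancel
  rintro a ha ⟨m', hm'⟩
  have h1 := (hg.1.isLcm_left hg.2 hΔ ha).2.2 m ⟨m', hm'⟩ hm.1
  have h2 := (hh.1.isLcm_left hh.2 hΔ ha).2.2 m ⟨m', hm'⟩ hm.2.1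
  rw [← hm'] at h1 h2
  obtain ⟨c, rfl⟩ := hm.2.2 m' h1.of_mul_left h2.of_mul_left
  exact (hΔ.eq_one_of_mul_mul_eq (by rw [mul_assoc, hm'])).1

theorem IsReducedRibbon.isRightReduced_lcm {X Y Z : ParabolicSubmonoid Δ} {g h m : M}
    (hg : IsReducedRibbon Y.carrier X.carrier g) (hh : IsReducedRibbon Z.carrier X.carrier h)
    (hΔ : IsMonoidalGarside Δ) (hm : IsLcm RightDvd g h m) : IsRightReduced X.carrier m := by
  have := hΔ.cancel
  rintro a ha ⟨m', hm'⟩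
  have h1 := (hg.1.isLcm_right ((hg.1.isReduced_iff hΔ).1 hg.2) hΔ ha).2.2 m ⟨m', hm'⟩ hm.1
  have h2 := (hh.1.isLcm_right ((hh.1.isReduced_iff hΔ).1 hh.2) hΔ ha).2.2 m ⟨m', hm'⟩ hm.2.1
  rw [← hm'] at h1 h2
  obtain ⟨c, rfl⟩ := hm.2.2 m' h1.of_mul_right h2.of_mul_right
  exact (hΔ.eq_one_of_mul_mul_eq hm').2

/-- The atoms of the positive ribbon category that do not belong to their source are reduced. -/
theorem IsNuFunction.isReducedRibbon_of_isCategoryAtom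
    {ν : ∀ X : ParabolicSubmonoid Δ, Atoms M → Out X} (hν : IsNuFunction ν)
    (hΔ : IsMonoidalGarside Δ) {X Y : ParabolicSubmonoid Δ} (f : X ⟶ Y) (hf : IsCategoryAtom f)
    (hfX : ribbonElt f ∉ X.carrier) : IsReducedRibbon X.carrier Y.carrier (ribbonElt f) := by
  have := hΔ.cancel
  refine ⟨ribbonElt_isRibbon f, fun a ha haf => by_contra fun ha1 => hfX ?_⟩
  obtain ⟨t, ht, hta⟩ := hΔ.exists_atom_leftDvd a ha1
  obtain ⟨δ, hδ, ⟨φ, hφ⟩, -, h2⟩ := X.exists_garside hΔ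
  have htδ := h2 t (hΔ.atom_leftDvd ht) a ha hta
  -- Since `δ` is a ribbon from `X` to itself, its gcd with `f` is a ribbon, non-trivial because `t`
  -- divides both. An atom `f` must equal it, so `f` divides `δ` and lies in `X`.
  obtain ⟨-, d, hd⟩ := hΔ.lattice_left (ribbonElt f) δ
  have hd1 : d ≠ 1 := by
    rintro rfl
    obtain ⟨c, hc⟩ := hd.2.2 t (hta.trans haf) htδ
    exact ht.1 (hΔ.eq_one_of_mul hc).1
  obtain ⟨W, hW⟩ := hν.isRibbon_gcd hΔ (ribbonElt_isRibbon f) (.of_equiv φ hφ) hd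
  obtain ⟨e, he⟩ := hd.1
  obtain ⟨fd, hfd⟩ := hW.exists_hom
  obtain ⟨fe, hfe⟩ := (hW.of_mul_left (he ▸ ribbonElt_isRibbon f)).exists_hom
  have hcomp : fd ≫ fe = f := PositiveRibbon.ext (by
    change ribbonElt fd * ribbonElt fe = ribbonElt f
    rw [hfd, hfe, he])
  rcases hf.2 W fd fe hcomp with h | h
  · exact absurd (hfd ▸ (isIdentity_iff fd).1 h) hd1
  · have he1 : e = 1 := hfe ▸ (isIdentity_iff fe).1 h
    rw [he1, mul_one] at he
    exact he ▸ X.mem_of_leftDvd hΔ hd.2.1 hδ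

/-- `Δ = δ r` for a reduced ribbon `r`. -/
theorem ParabolicSubmonoid.exists_reduced_garside (X : ParabolicSubmonoid Δ)
    (hΔ : IsMonoidalGarside Δ) : ∃ δ ∈ X.carrier, ∃ r, IsReduced X.carrier r ∧ δ * r = Δ ∧
      IsRibbon X.carrier X.carrier δ := by
  have := hΔ.cancel
  obtain ⟨δ, hδ, ⟨φ, hφ⟩, h1, h2⟩ := X.exists_garside hΔ
  obtain ⟨r, hr⟩ := ((h1 δ).1 (.refl δ)).1
  refine ⟨δ, hδ, r, fun a ha har => ?_, hr, .of_equiv φ hφ⟩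
  -- `δ a` is a divisor of `Δ` in `X`, hence divides `δ`.
  have h3 := (h1 (δ * a)).2 ⟨hr ▸ har.mul_left δ, X.carrier.mul_mem hδ ha⟩
  have h4 := hΔ.leftDvd_antisymm h3 (leftDvd_mul δ a)
  rwa [mul_eq_left] at h4

theorem IsReducedRibbon.map {X Y : ParabolicSubmonoid Δ} {g : M}
    (h : IsReducedRibbon X.carrier Y.carrier g) (Ψ : M ≃* M) (hΨ : Ψ Δ = Δ) :
    IsReducedRibbon (X.map Ψ hΨ).carrier (Y.map Ψ hΨ).carrier (Ψ g) := by
  refine ⟨h.1.map Ψ hΨ, ?_⟩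
  rintro _ ⟨a, ha, rfl⟩ hag
  have := h.2 a ha ((leftDvd_map_iff Ψ).1 hag)
  subst this
  exact map_one Ψ

theorem IsReducedRibbon.of_map {X Y : ParabolicSubmonoid Δ} {g : M} {Ψ : M ≃* M} {hΨ : Ψ Δ = Δ}
    (h : IsReducedRibbon (X.map Ψ hΨ).carrier (Y.map Ψ hΨ).carrier (Ψ g)) :
    IsReducedRibbon X.carrier Y.carrier g := by
  refine ⟨⟨fun a ha => ?_, fun b hb => ?_⟩, fun a ha hag => ?_⟩
  · obtain ⟨_, ⟨b, hb, rfl⟩, hab⟩ := h.1.1 (Ψ a) ⟨a, ha, rfl⟩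
    exact ⟨b, hb, Ψ.injective (by simpa using hab)⟩
  · obtain ⟨_, ⟨a, ha, rfl⟩, hab⟩ := h.1.2 (Ψ b) ⟨b, hb, rfl⟩
    exact ⟨a, ha, Ψ.injective (by simpa using hab)⟩
  · simpa using h.2 (Ψ a) ⟨a, ha, rfl⟩ ((leftDvd_map_iff Ψ).2 hag)

end Reduced

/-! ### Fractions: from the monoid to the group -/

section Fractions

variable {M : Type u} [Monoid M] {A : Type v} [Group A] {ι : M →* A} {Δ : M}

theorem mem_subgroupOf (X : ParabolicSubmonoid Δ) {a : M} (ha : a ∈ X.carrier) :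
    ι a ∈ subgroupOf ι X := Subgroup.subset_closure ⟨a, ha, rfl⟩

/-- The Ore condition holds inside `X`: a middle term `q⁻¹ p'` is rewritten as `u v⁻¹` through the
lcm of `q` and `p'`, whose factors stay in `X`. -/
theorem exists_right_fraction (hΔ : IsMonoidalGarside Δ) (X : ParabolicSubmonoid Δ) {x : A}
    (hx : x ∈ subgroupOf ι X) : ∃ p ∈ X.carrier, ∃ q ∈ X.carrier, x = ι p * (ι q)⁻¹ := by
  induction hx using Subgroup.closure_induction with
  | mem x hx =>
    obtain ⟨a, ha, rfl⟩ := hx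
    exact ⟨a, ha, 1, X.carrier.one_mem, by simp⟩
  | one => exact ⟨1, X.carrier.one_mem, 1, X.carrier.one_mem, by simp⟩
  | inv x _ h =>
    obtain ⟨p, hp, q, hq, rfl⟩ := h
    exact ⟨q, hq, p, hp, by simp⟩
  | mul x y _ _ hx hy =>
    obtain ⟨p, hp, q, hq, rfl⟩ := hx
    obtain ⟨p', hp', q', hq', rfl⟩ := hy
    obtain ⟨⟨m, hm⟩, -⟩ := hΔ.lattice_left q p'
    have hmX := X.lcm_left_mem hΔ hq hp' hm
    obtain ⟨⟨u, rfl⟩, ⟨v, hv⟩, -⟩ := hm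
    have hu := (X.mem_of_mul_mem hΔ hmX).2
    have hv' := (X.mem_of_mul_mem hΔ (hv ▸ hmX)).2
    refine ⟨p * u, mul_mem hp hu, q' * v, mul_mem hq' hv', ?_⟩
    have h := congrArg ι hv
    rw [map_mul, map_mul] at h
    have h' : (ι q)⁻¹ * ι p' = ι u * (ι v)⁻¹ := by
      rw [inv_mul_eq_iff_eq_mul, ← mul_assoc, eq_mul_inv_iff_mul_eq, h]
    calc ι p * (ι q)⁻¹ * (ι p' * (ι q')⁻¹) = ι p * ((ι q)⁻¹ * ι p') * (ι q')⁻¹ := by group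
      _ = _ := by rw [h', map_mul, map_mul]; group

theorem exists_left_fraction (hΔ : IsMonoidalGarside Δ) (X : ParabolicSubmonoid Δ) {x : A}
    (hx : x ∈ subgroupOf ι X) : ∃ p ∈ X.carrier, ∃ q ∈ X.carrier, x = (ι p)⁻¹ * ι q := by
  obtain ⟨p, hp, q, hq, rfl⟩ := exists_right_fraction hΔ X hx
  obtain ⟨⟨m, hm⟩, -⟩ := hΔ.lattice_right p q
  have hmX := X.lcm_right_mem hΔ hp hq hm
  obtain ⟨⟨u, rfl⟩, ⟨v, hv⟩, -⟩ := hm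
  refine ⟨u, (X.mem_of_mul_mem hΔ hmX).1, v, (X.mem_of_mul_mem hΔ (hv ▸ hmX)).1, ?_⟩
  have h := congrArg ι hv
  rw [map_mul, map_mul] at h
  rw [eq_inv_mul_iff_mul_eq, ← mul_assoc, mul_inv_eq_iff_eq_mul, h]

/-- From `a = p q⁻¹` one gets `a q = p` in `X`, and `X` is closed under factors. -/
theorem mem_of_mem_subgroupOf (hΔ : IsMonoidalGarside Δ) (hι : IsGroupOfFractions ι)
    (X : ParabolicSubmonoid Δ) {a : M} (ha : ι a ∈ subgroupOf ι X) : a ∈ X.carrier := by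
  obtain ⟨p, hp, q, hq, h⟩ := exists_right_fraction hΔ X ha
  rw [eq_mul_inv_iff_mul_eq, ← map_mul] at h
  exact (X.mem_of_mul_mem hΔ (hι.injective h ▸ hp)).1

theorem pos_toSubgroup (hΔ : IsMonoidalGarside Δ) (hι : IsGroupOfFractions ι)
    (X : ParabolicSubmonoid Δ) : (X.toSubgroup ι).pos = ι '' (X.carrier : Set M) := by
  ext x
  constructor
  · rintro ⟨hx, a, rfl⟩
    exact ⟨a, mem_of_mem_subgroupOf hΔ hι X hx, rfl⟩
  · rintro ⟨a, ha, rfl⟩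
    exact ⟨mem_subgroupOf X ha, a, rfl⟩

theorem toSubgroup_injective (hΔ : IsMonoidalGarside Δ) (hι : IsGroupOfFractions ι) :
    Function.Injective (ParabolicSubmonoid.toSubgroup ι (Δ := Δ)) := by
  intro X Y h
  have h' := congrArg ParabolicSubgroup.pos h
  rw [pos_toSubgroup hΔ hι, pos_toSubgroup hΔ hι] at h'
  exact ParabolicSubmonoid.ext_carrier (SetLike.coe_injective (hι.injective.image_injective h'))

theorem ParabolicSubgroup.exists_toSubgroup_eq (H : ParabolicSubgroup ι Δ) :
    ∃ X : ParabolicSubmonoid Δ, X.toSubgroup ι = H := by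
  obtain ⟨H, X, rfl⟩ := H
  exact ⟨X, rfl⟩

theorem conjSet_subgroup (g : A) (H : Subgroup A) :
    conjSet g (H : Set A) = (H.map (MulAut.conj g⁻¹).toMonoidHom : Subgroup A) := by
  ext x
  simp [conjSet, mul_assoc]

theorem IsRibbon.conjSet_image {P Q : Submonoid M} {g : M} (h : IsRibbon P Q g) :
    conjSet (ι g) (ι '' (P : Set M)) = ι '' (Q : Set M) := by
  have key : ∀ a b, a * g = g * b → (ι g)⁻¹ * ι a * ι g = ι b := fun a b hab => by
    rw [mul_assoc, ← map_mul, hab, map_mul, inv_mul_cancel_left]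
  ext x
  constructor
  · rintro ⟨_, ⟨a, ha, rfl⟩, rfl⟩
    obtain ⟨b, hb, hab⟩ := h.1 a ha
    exact ⟨b, hb, (key a b hab).symm⟩
  · rintro ⟨b, hb, rfl⟩
    obtain ⟨a, ha, hab⟩ := h.2 b hb
    exact ⟨ι a, ⟨a, ha, rfl⟩, key a b hab⟩

theorem IsRibbon.conjSet_subgroupOf {X Y : ParabolicSubmonoid Δ} {g : M}
    (h : IsRibbon X.carrier Y.carrier g) :
    conjSet (ι g) (subgroupOf ι X : Set A) = subgroupOf ι Y := by
  rw [conjSet_subgroup, subgroupOf, MonoidHom.map_closure, subgroupOf, ← h.conjSet_image (ι := ι)]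
  congr 2
  ext x
  simp [conjSet, mul_assoc]

/-- The morphism of `Conj(A)` given by a positive ribbon. -/
def IsRibbon.toConj (ι : M →* A) {X Y : ParabolicSubmonoid Δ} {g : M}
    (h : IsRibbon X.carrier Y.carrier g) : X.toSubgroup ι ⟶ Y.toSubgroup ι :=
  (⟨ι g, h.conjSet_subgroupOf⟩ : Conjugator _ _)

theorem IsRibbon.conjElt_toConj {X Y : ParabolicSubmonoid Δ} {g : M}
    (h : IsRibbon X.carrier Y.carrier g) : conjElt (h.toConj ι) = ι g := rfl

theorem IsRibbon.toConj_mem (hΔ : IsMonoidalGarside Δ) (hι : IsGroupOfFractions ι)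
    {X Y : ParabolicSubmonoid Δ} {g : M} (h : IsRibbon X.carrier Y.carrier g) :
    h.toConj ι ∈ (ribbonGroupoid ι Δ).arrows _ _ := by
  change conjSet (ι g) _ = _
  rw [pos_toSubgroup hΔ hι, pos_toSubgroup hΔ hι, h.conjSet_image]

theorem conjElt_injective {H K : ParabolicSubgroup ι Δ} {f g : H ⟶ K} (h : conjElt f = conjElt g) :
    f = g := Conjugator.ext h

theorem conjElt_comp {H K L : ParabolicSubgroup ι Δ} (f : H ⟶ K) (g : K ⟶ L) :
    conjElt (f ≫ g) = conjElt f * conjElt g := rfl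

theorem conjElt_id (H : ParabolicSubgroup ι Δ) : conjElt (𝟙 H) = 1 := rfl

theorem conjElt_inv {H K : ParabolicSubgroup ι Δ} (f : H ⟶ K) :
    conjElt (Groupoid.inv f) = (conjElt f)⁻¹ := rfl

variable (ι Δ) in
/-- The groupoid of fractions of the category of reduced positive ribbons. -/
def reducedFractions (hΔ : IsMonoidalGarside Δ) (hι : IsGroupOfFractions ι)
    (hlcm : ∀ {X Y Z : ParabolicSubmonoid Δ} {g h m : M}, IsRibbon X.carrier Y.carrier g →
      IsRibbon X.carrier Z.carrier h → IsLcm LeftDvd g h m →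
      ∃ W : ParabolicSubmonoid Δ, IsRibbon X.carrier W.carrier m) :
    Subgroupoid (ParabolicSubgroup ι Δ) where
  arrows H K := {f | ∃ (X Y Z : ParabolicSubmonoid Δ) (a b : M), X.toSubgroup ι = H ∧
    Y.toSubgroup ι = K ∧ IsReducedRibbon X.carrier Z.carrier a ∧
    IsReducedRibbon Y.carrier Z.carrier b ∧ conjElt f = ι a * (ι b)⁻¹}
  inv := by
    rintro H K f ⟨X, Y, Z, a, b, hX, hY, ha, hb, hf⟩
    exact ⟨Y, X, Z, b, a, hY, hX, hb, ha, by rw [conjElt_inv, hf]; simp⟩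
  mul := by
    rintro H K L f ⟨X, Y, Z, a, b, hX, hY, ha, hb, hf⟩ f' ⟨Y', X', Z', c, d, hY', hX', hc, hd, hf'⟩
    have := hΔ.cancel
    obtain rfl := toSubgroup_injective hΔ hι (hY.trans hY'.symm)
    -- To compose `a b⁻¹` with `c d⁻¹`, write the lcm of `b` and `c` as `b u = c v`. It is a reduced
    -- ribbon, and therefore so are `u` and `v`.
    obtain ⟨⟨m, hm⟩, -⟩ := hΔ.lattice_left b c
    have hmr := hb.isReduced_lcm hc hΔ hm
    obtain ⟨W, hW⟩ := hlcm hb.1 hc.1 hm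
    obtain ⟨⟨u, rfl⟩, ⟨v, hv⟩, -⟩ := hm
    have hu := IsReducedRibbon.of_mul_left hb.1 ⟨hW, hmr⟩ hΔ
    have hv' := IsReducedRibbon.of_mul_left (h := v) (Z := W) hc.1
      (by rw [hv]; exact ⟨hW, hmr⟩) hΔ
    refine ⟨X, X', W, a * u, d * v, hX, hX', ha.mul hu hΔ, hd.mul hv' hΔ, ?_⟩
    have h := congrArg ι hv
    rw [map_mul, map_mul] at h
    have h' : (ι b)⁻¹ * ι c = ι u * (ι v)⁻¹ := by
      rw [inv_mul_eq_iff_eq_mul, ← mul_assoc, eq_mul_inv_iff_mul_eq, h]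
    rw [conjElt_comp, hf, hf']
    calc ι a * (ι b)⁻¹ * (ι c * (ι d)⁻¹) = ι a * ((ι b)⁻¹ * ι c) * (ι d)⁻¹ := by group
      _ = _ := by rw [h', map_mul, map_mul]; group

end Fractions

/-! ### The groupoid `R^ν(A)` and reduced ribbons -/

section NuGroupoid

variable {M : Type u} [Monoid M] {A : Type v} [Group A] {ι : M →* A} {Δ : M}
  {ν : ∀ X : ParabolicSubmonoid Δ, Atoms M → Out X}
  {ν' : ∀ X : ParabolicSubmonoid Δ, Atoms M → In X}

theorem generated_le {G : Type*} [Groupoid G] {E : ∀ x y : G, Set (x ⟶ y)} {S : Subgroupoid G}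
    (h : ∀ x y, E x y ⊆ S.arrows x y) : Subgroupoid.generated E ≤ S :=
  sInf_le h

theorem eqToHom_mem_nuGroupoid {H K : ParabolicSubgroup ι Δ} (e : H = K) :
    eqToHom e ∈ (nuGroupoid ι ν).arrows H K := by
  have h : Subgroupoid.discrete ≤ nuGroupoid ι ν := le_sup_right
  exact (Subgroupoid.le_iff _ _).1 h ((Subgroupoid.mem_discrete_iff _).2 ⟨e, rfl⟩)

/-- If an atom `s` divides a reduced ribbon `g`, so does `ν_X(s)`; being non-trivial it is not in
`X`, hence is a generator. The quotient is again a reduced ribbon. -/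
theorem IsNuFunction.mem_nuGroupoid (hν : IsNuFunction ν) (hΔ : IsMonoidalGarside Δ)
    {X Y : ParabolicSubmonoid Δ} {g : M} (hg : IsReducedRibbon X.carrier Y.carrier g) :
    hg.1.toConj ι ∈ (nuGroupoid ι ν).arrows _ _ := by
  have := hΔ.cancel
  induction g using hΔ.induction_right_factor generalizing X with
  | _ g ih =>
    by_cases hg1 : g = 1
    · subst hg1
      obtain rfl : X = Y := ParabolicSubmonoid.ext_carrier ((IsRibbon.one _).target_unique hg.1)
      convert! eqToHom_mem_nuGroupoid (ν := ν) (rfl : X.toSubgroup ι = X.toSubgroup ι)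
      exact conjElt_injective (map_one ι)
    obtain ⟨s, hs, hsg⟩ := hΔ.exists_atom_leftDvd g hg1
    obtain ⟨f, rfl⟩ := hg.1.exists_hom
    obtain ⟨g', hg'⟩ := hν.dvd X ⟨s, hs⟩ ⟨Y, f⟩ hsg
    have hz1 : ribbonElt (ν X ⟨s, hs⟩).2 ≠ 1 := (isIdentity_iff _).not.1 (hν.atom X ⟨s, hs⟩).1
    have hzr := ribbonElt_isRibbon (ν X ⟨s, hs⟩).2
    have hzX : ribbonElt (ν X ⟨s, hs⟩).2 ∉ X.carrier := fun h => hz1 (hg.2 _ h ⟨g', hg'⟩)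
    have hg'r := IsReducedRibbon.of_mul_left hzr (hg' ▸ hg) hΔ
    have hle : Subgroupoid.generated (nuEdges ι ν) ≤ nuGroupoid ι ν := le_sup_left
    have hz := (Subgroupoid.le_iff _ _).1 hle (Subgroupoid.subset_generated (nuEdges ι ν) _ _
      (show hzr.toConj ι ∈ nuEdges ι ν _ _ from ⟨X, ⟨s, hs⟩, rfl, rfl, hzX, rfl⟩))
    convert! (nuGroupoid ι ν).mul hz (ih _ g' hz1 hg' hg'r)
    refine conjElt_injective ?_
    rw [conjElt_comp, IsRibbon.conjElt_toConj, IsRibbon.conjElt_toConj, IsRibbon.conjElt_toConj,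
      ← map_mul, hg']

/-- Together with `IsNuFunction.mem_nuGroupoid`, this characterizes `R^ν(A)` as the smallest
subgroupoid containing all identities and reduced ribbons. -/
theorem IsNuFunction.nuGroupoid_le (hν : IsNuFunction ν) (hΔ : IsMonoidalGarside Δ)
    {S : Subgroupoid (ParabolicSubgroup ι Δ)} (h1 : ∀ H, 𝟙 H ∈ S.arrows H H)
    (h : ∀ {X Y : ParabolicSubmonoid Δ} {g : M} (hg : IsReducedRibbon X.carrier Y.carrier g),
      hg.1.toConj ι ∈ S.arrows _ _) : nuGroupoid ι ν ≤ S := by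
  refine sup_le (generated_le ?_) ?_
  · rintro _ _ f ⟨X, s, rfl, rfl, hX, hf⟩
    obtain rfl : (ribbonElt_isRibbon (ν X s).2).toConj ι = f := conjElt_injective hf.symm
    exact h (hν.isReducedRibbon_of_isCategoryAtom hΔ _ (hν.atom X s) hX)
  · rw [Subgroupoid.le_iff]
    rintro H K f hf
    obtain ⟨rfl, rfl⟩ := (Subgroupoid.mem_discrete_iff f).1 hf
    exact h1 H

theorem exists_mem_nuGroupoid (hν : IsNuFunction ν) (hν' : IsNuTildeFunction ν')
    (hΔ : IsMonoidalGarside Δ) (hι : IsGroupOfFractions ι) {X Y : ParabolicSubmonoid Δ}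
    {f : X.toSubgroup ι ⟶ Y.toSubgroup ι} (hf : f ∈ (nuGroupoid ι ν).arrows _ _) :
    ∃ (Z : ParabolicSubmonoid Δ) (a b : M), IsReducedRibbon X.carrier Z.carrier a ∧
      IsReducedRibbon Y.carrier Z.carrier b ∧ conjElt f = ι a * (ι b)⁻¹ := by
  have hle : nuGroupoid ι ν ≤ reducedFractions ι Δ hΔ hι (hν'.isRibbon_lcm hΔ) := by
    refine hν.nuGroupoid_le hΔ (fun H => ?_) fun {X Y g} hg => ?_
    · obtain ⟨X, rfl⟩ := H.exists_toSubgroup_eq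
      exact ⟨X, X, X, 1, 1, rfl, rfl, .one hΔ _, .one hΔ _, by simp [conjElt_id]⟩
    · exact ⟨X, Y, Y, g, 1, rfl, rfl, hg, .one hΔ _, by simp [IsRibbon.conjElt_toConj]⟩
  obtain ⟨X', Y', Z, a, b, hX, hY, h⟩ := (Subgroupoid.le_iff _ _).1 hle hf
  obtain rfl := toSubgroup_injective hΔ hι hX
  obtain rfl := toSubgroup_injective hΔ hι hY
  exact ⟨Z, a, b, h⟩

/-- Equating `a b⁻¹`, a fraction of reduced ribbons, with `p⁻¹ q` in `A_X` gives `p a = q b`, so `a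
= b`. -/
theorem eq_id_of_mem_nuGroupoid (hν : IsNuFunction ν) (hν' : IsNuTildeFunction ν')
    (hΔ : IsMonoidalGarside Δ) (hι : IsGroupOfFractions ι) {H : ParabolicSubgroup ι Δ} {f : H ⟶ H}
    (hf : f ∈ (nuGroupoid ι ν).arrows H H) (hf' : conjElt f ∈ H.carrier) : f = 𝟙 H := by
  obtain ⟨X, rfl⟩ := H.exists_toSubgroup_eq
  obtain ⟨Z, a, b, ha, hb, h⟩ := exists_mem_nuGroupoid hν hν' hΔ hι hf
  obtain ⟨p, hp, q, hq, h'⟩ := exists_left_fraction hΔ X hf'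
  rw [h, eq_inv_mul_iff_mul_eq, ← mul_assoc, mul_inv_eq_iff_eq_mul, ← map_mul, ← map_mul] at h'
  obtain ⟨-, rfl⟩ := ha.2.mul_eq_mul hb.2 hΔ hp hq (hι.injective h')
  refine conjElt_injective ?_
  rw [h, conjElt_id, mul_inv_cancel]

theorem conj_mem_of_conjSet {g : A} {H K : Subgroup A} (h : conjSet g (H : Set A) = K) :
    (∀ x ∈ H, g⁻¹ * x * g ∈ K) ∧ ∀ y ∈ K, g * y * g⁻¹ ∈ H := by
  refine ⟨fun x hx => h.subset ⟨x, hx, rfl⟩, fun y hy => ?_⟩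
  obtain ⟨x, hx, rfl⟩ := (h.superset hy : y ∈ conjSet g (H : Set A))
  simpa [mul_assoc] using hx

/-- A positive element that conjugates a parabolic subgroup to another one is the product of a
reduced ribbon and of elements of the two parabolic submonoids. -/
theorem exists_isReducedRibbon_of_conjSet (hΔ : IsMonoidalGarside Δ) (hι : IsGroupOfFractions ι)
    {X Y : ParabolicSubmonoid Δ} {g : M}
    (hg : conjSet (ι g) (subgroupOf ι X : Set A) = subgroupOf ι Y) :
    ∃ p ∈ X.carrier, ∃ q ∈ Y.carrier, ∃ r, IsReducedRibbon X.carrier Y.carrier r ∧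
      p * r * q = g := by
  have := hΔ.cancel
  obtain ⟨p, hp, g₁, hg₁, rfl⟩ := hΔ.exists_mul_isReduced X.carrier g
  obtain ⟨q, hq, r, hr, rfl⟩ := hΔ.exists_isRightReduced_mul Y.carrier g₁
  have hr' := hg₁.of_leftDvd (leftDvd_mul r q)
  refine ⟨p, hp, q, hq, r, ⟨⟨fun a ha => ?_, fun b hb => ?_⟩, hr'⟩, mul_assoc _ _ _⟩
  all_goals
    obtain ⟨h1, h2⟩ := conj_mem_of_conjSet hg
    have hp' := mem_subgroupOf (ι := ι) X hp
    have hq' := mem_subgroupOf (ι := ι) Y hq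
  -- Write `r⁻¹ a r = u v⁻¹` in `A_Y`. Then `a r v = r u`, so `v` right-divides `r u`, and hence `u`
  -- because `r` is right-reduced; the fraction is positive.
  · have h3 : (ι r)⁻¹ * ι a * ι r ∈ subgroupOf ι Y := by
      have := mul_mem (mul_mem hq' (h1 _ (mul_mem (mul_mem hp' (mem_subgroupOf X ha))
        (inv_mem hp')))) (inv_mem hq')
      convert! this using 1
      simp only [map_mul]
      group
    obtain ⟨u, hu, v, hv, h4⟩ := exists_right_fraction hΔ Y h3
    obtain ⟨w, rfl⟩ : RightDvd v u := by
      refine hr.rightDvd_of_mul hΔ hv hu ⟨a * r, hι.injective ?_⟩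
      rw [eq_mul_inv_iff_mul_eq] at h4
      rw [map_mul, map_mul, map_mul, ← h4]
      group
    refine ⟨w, (Y.mem_of_mul_mem hΔ hu).1, hι.injective ?_⟩
    rw [map_mul, mul_inv_cancel_right, mul_assoc, inv_mul_eq_iff_eq_mul] at h4
    rw [map_mul, map_mul, h4]
  · have h3 : ι r * ι b * (ι r)⁻¹ ∈ subgroupOf ι X := by
      have := mul_mem (mul_mem (inv_mem hp') (h2 _ (mul_mem (mul_mem (inv_mem hq')
        (mem_subgroupOf Y hb)) hq'))) hp'
      convert! this using 1
      simp only [map_mul]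
      group
    obtain ⟨u, hu, v, hv, h4⟩ := exists_left_fraction hΔ X h3
    obtain ⟨w, rfl⟩ : LeftDvd u v := by
      refine hr'.leftDvd_of_mul hΔ hu hv ⟨r * b, hι.injective ?_⟩
      rw [eq_inv_mul_iff_mul_eq] at h4
      rw [map_mul, map_mul, map_mul, ← h4]
      group
    refine ⟨w, (X.mem_of_mul_mem hΔ hv).2, hι.injective ?_⟩
    rw [map_mul, inv_mul_cancel_left, mul_inv_eq_iff_eq_mul] at h4
    rw [map_mul, map_mul, h4]

/-- Both `f Δⁿ` and `Δⁿ` are positive conjugators, into the same parabolic subgroup `Ψ(A_Y)`. With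
`r` and `r'` their reduced cores, `r r'⁻¹` is the required morphism. -/
theorem exists_mul_nuGroupoid (hν : IsNuFunction ν) (hΔ : IsMonoidalGarside Δ)
    (hι : IsGroupOfFractions ι) {H K : ParabolicSubgroup ι Δ} (f : H ⟶ K) :
    ∃ r ∈ (nuGroupoid ι ν).arrows H K, conjElt f * (conjElt r)⁻¹ ∈ H.carrier := by
  obtain ⟨X, rfl⟩ := H.exists_toSubgroup_eq
  obtain ⟨Y, rfl⟩ := K.exists_toSubgroup_eq
  obtain ⟨a, b, hab⟩ := hι.exists_fraction (conjElt f)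
  obtain ⟨n, c, hc⟩ := hΔ.exists_leftDvd_pow b
  obtain ⟨Ψ, hΨ, hD⟩ := hΔ.exists_automorphism_pow n
  have hDr := Y.isRibbon_map hΨ hD
  have hfD : conjElt f * ι (Δ ^ n) = ι (a * c) := by
    rw [hab, ← hc, map_mul, map_mul]
    group
  have hf : conjSet (conjElt f) (subgroupOf ι X : Set A) = subgroupOf ι Y := Conjugator.conj_eq f
  obtain ⟨p, hp, q, hq, r, hr, he⟩ := exists_isReducedRibbon_of_conjSet hΔ hι (ι := ι) (X := X)
    (Y := Y.map Ψ hΨ) (g := a * c) (by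
      rw [← hfD, conjSet_mul, hf, hDr.conjSet_subgroupOf])
  obtain ⟨p', hp', q', hq', r', hr', he'⟩ := exists_isReducedRibbon_of_conjSet hΔ hι
    hDr.conjSet_subgroupOf
  refine ⟨_, (nuGroupoid ι ν).mul (hν.mem_nuGroupoid hΔ hr)
    ((nuGroupoid ι ν).inv (hν.mem_nuGroupoid hΔ hr')), ?_⟩
  rw [conjElt_comp, conjElt_inv, IsRibbon.conjElt_toConj, IsRibbon.conjElt_toConj]
  have hfe : conjElt f = ι (p * r * q) * (ι (p' * r' * q'))⁻¹ := by
    rw [he, he', ← hfD, mul_inv_cancel_right]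
  -- `f (r r'⁻¹)⁻¹ = p · r (q q'⁻¹ · r'⁻¹ p'⁻¹ r') r⁻¹`: the element `p'⁻¹` is carried into `Ψ(A_Y)`
  -- by `r'`, and the parenthesis back into `A_X` by `r`.
  have h1 := (conj_mem_of_conjSet (hr'.1.conjSet_subgroupOf (ι := ι))).1 _
    (inv_mem (mem_subgroupOf Y hp'))
  have h2 := (conj_mem_of_conjSet (hr.1.conjSet_subgroupOf (ι := ι))).2 _
    (mul_mem (mul_mem (mem_subgroupOf _ hq) (inv_mem (mem_subgroupOf _ hq'))) h1)
  have h3 := mul_mem (mem_subgroupOf (ι := ι) X hp) h2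
  change _ ∈ subgroupOf ι X
  convert! h3 using 1
  rw [hfe]
  simp only [map_mul]
  group

end NuGroupoid

/-! ### A criterion for semi-direct products -/

section SemidirectProduct

theorem isSemidirectProduct_of_exists_of_unique {G : Type*} [Groupoid G] {C D D' : Subgroupoid G}
    (hD : D ≤ C) (hD' : D' ≤ C) (hdisc : ∀ x y, ∀ f ∈ D.arrows x y, x = y)
    (hex : ∀ x y, ∀ g ∈ C.arrows x y, ∃ d ∈ D.arrows x x, ∃ r ∈ D'.arrows x y, d ≫ r = g)
    (huniq : ∀ x, ∀ f ∈ D.arrows x x, f ∈ D'.arrows x x → f = 𝟙 x)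
    (hconj : ∀ x y, ∀ g ∈ D'.arrows x y,
      (fun d : x ⟶ x => d ≫ g) '' D.arrows x x = (fun d : y ⟶ y => g ≫ d) '' D.arrows y y) :
    IsSemidirectProduct C D D' := by
  refine ⟨⟨hD, hD', fun x y g hg => ?_⟩, hdisc, hconj⟩
  obtain ⟨d, hd, r, hr, rfl⟩ := hex x y g hg
  refine ⟨⟨x, d, r⟩, ⟨hd, hr, rfl⟩, ?_⟩
  rintro ⟨z, d', r'⟩ ⟨hd', hr', h⟩
  obtain rfl := hdisc _ _ _ hd'
  simp only at d' r' hd' hr' h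
  -- The discrepancy of two factorizations lies in both `D` and `D'`, so it is an identity.
  have h1 : Groupoid.inv d ≫ d' = r ≫ Groupoid.inv r' := by
    simp [Groupoid.inv_eq_inv, ← h]
  have h2 := huniq _ _ (D.mul (D.inv hd) hd') (h1 ▸ D'.mul hr (D'.inv hr'))
  have hd : d' = d := by
    simpa [Groupoid.inv_eq_inv, IsIso.inv_comp_eq] using h2
  subst hd
  have hr : r' = r := (cancel_epi d').1 h
  rw [hr]

end SemidirectProduct

/-! ### The two decompositions and the parabolic subcategory -/

section Main

variable {M : Type u} [Monoid M] {A : Type v} [Group A] {ι : M →* A} {Δ : M}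
  {ν : ∀ X : ParabolicSubmonoid Δ, Atoms M → Out X}
  {ν' : ∀ X : ParabolicSubmonoid Δ, Atoms M → In X}

theorem isSemidirectProduct_conj (hν : IsNuFunction ν) (hν' : IsNuTildeFunction ν')
    (hΔ : IsMonoidalGarside Δ) (hι : IsGroupOfFractions ι) :
    IsSemidirectProduct ⊤ (parabolicGroupoid ι Δ) (nuGroupoid ι ν) := by
  refine isSemidirectProduct_of_exists_of_unique le_top le_top (fun _ _ _ hf => hf.1) ?_
    (fun H f hf hf' => eq_id_of_mem_nuGroupoid hν hν' hΔ hι hf' hf.2) ?_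
  · intro H K f _
    obtain ⟨r, hr, h⟩ := exists_mul_nuGroupoid hν hΔ hι f
    exact ⟨f ≫ Groupoid.inv r, ⟨rfl, h⟩, r, hr, by simp [Groupoid.inv_eq_inv]⟩
  · intro H K g _
    obtain ⟨h1, h2⟩ := conj_mem_of_conjSet (Conjugator.conj_eq g)
    ext f
    constructor
    · rintro ⟨d, ⟨-, hd⟩, rfl⟩
      exact ⟨Groupoid.inv g ≫ d ≫ g, ⟨rfl, by
        rw [conjElt_comp, conjElt_comp, conjElt_inv, ← mul_assoc]
        exact h1 _ hd⟩, by
        simp [Groupoid.inv_eq_inv]⟩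
    · rintro ⟨d, ⟨-, hd⟩, rfl⟩
      exact ⟨g ≫ d ≫ Groupoid.inv g, ⟨rfl, by
        rw [conjElt_comp, conjElt_comp, conjElt_inv, ← mul_assoc]
        exact h2 _ hd⟩, by
        simp [Groupoid.inv_eq_inv]⟩

/-- A modular law: as `D' ≤ C`, the `D`-component of a morphism of `C` is in `C`. This deduces (i)
from (ii). -/
theorem IsSemidirectProduct.inf {G : Type*} [Groupoid G] {D D' C : Subgroupoid G}
    (h : IsSemidirectProduct ⊤ D D') (hC : D' ≤ C) : IsSemidirectProduct C (D ⊓ C) D' := by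
  rw [Subgroupoid.le_iff] at hC
  refine ⟨⟨inf_le_right, (Subgroupoid.le_iff _ _).2 @hC, fun x y g hg => ?_⟩,
    fun x y f hf => h.totallyDisconnected x y f hf.1, fun x y g hg => ?_⟩
  · obtain ⟨⟨z, d, r⟩, ⟨hd, hr, rfl⟩, hu⟩ := h.zappaSzep.existsUnique x y g trivial
    exact ⟨⟨z, d, r⟩, ⟨⟨hd, (C.mul_mem_cancel_right (hC hr)).1 hg⟩, hr, rfl⟩,
      fun p hp => hu p ⟨hp.1.1, hp.2⟩⟩
  · have hg' := hC hg
    have := h.conj x y g hg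
    ext f
    constructor
    · rintro ⟨d, hd, rfl⟩
      obtain ⟨e, he, he'⟩ := this.subset ⟨d, hd.1, rfl⟩
      exact ⟨e, ⟨he, (C.mul_mem_cancel_left hg').1 (he'.symm.subst
        (motive := fun f => f ∈ C.arrows x y) (C.mul hd.2 hg'))⟩, he'⟩
    · rintro ⟨d, hd, rfl⟩
      obtain ⟨e, he, he'⟩ := this.superset ⟨d, hd.1, rfl⟩
      exact ⟨e, ⟨he, (C.mul_mem_cancel_right hg').1 (he'.symm.subst
        (motive := fun f => f ∈ C.arrows x y) (C.mul hg' hd.2))⟩, he'⟩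

theorem quasiCentralizerGroupoid_eq :
    quasiCentralizerGroupoid ι Δ = parabolicGroupoid ι Δ ⊓ ribbonGroupoid ι Δ := by
  have key : ∀ (g : A) (T : Set A),
      (fun a => g * a) '' T = (fun a => a * g) '' T ↔ conjSet g T = T := by
    intro g T
    have h : (fun a => g * a) '' conjSet g T = (fun a => a * g) '' T := by
      simp [conjSet, Set.image_image, ← mul_assoc]
    rw [← h, (Set.image_injective.2 (mul_right_injective g)).eq_iff, eq_comm]
  ext H K f
  constructor
  · rintro ⟨rfl, hf, hf'⟩
    exact ⟨⟨rfl, hf⟩, (key _ _).1 hf'⟩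
  · rintro ⟨⟨rfl, hf⟩, hf'⟩
    exact ⟨rfl, hf, (key _ _).2 hf'⟩

theorem nuGroupoid_le_ribbonGroupoid (hν : IsNuFunction ν) (hΔ : IsMonoidalGarside Δ)
    (hι : IsGroupOfFractions ι) : nuGroupoid ι ν ≤ ribbonGroupoid ι Δ :=
  hν.nuGroupoid_le hΔ (fun _ => conjSet_one _) fun hg => hg.1.toConj_mem hΔ hι

theorem range_conjElt (H : ParabolicSubgroup ι Δ) :
    Set.range (fun f : H ⟶ H => conjElt f) = (Subgroup.normalizer (H.carrier : Set A) : Set A) := by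
  ext g
  constructor
  · rintro ⟨f, rfl⟩
    obtain ⟨h1, h2⟩ := conj_mem_of_conjSet (Conjugator.conj_eq f)
    refine fun x => ⟨h2 x, fun hx => ?_⟩
    have := h1 _ hx
    change (conjElt f)⁻¹ * (conjElt f * x * (conjElt f)⁻¹) * conjElt f ∈ _ at this
    simpa [mul_assoc] using this
  · intro hg
    have hg : ∀ x, x ∈ H.carrier ↔ g * x * g⁻¹ ∈ H.carrier := hg
    refine ⟨(⟨g, Set.ext fun x => ⟨?_, fun hx => ⟨_, (hg x).1 hx, by simp [mul_assoc]⟩⟩⟩ :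
      Conjugator H H), rfl⟩
    rintro ⟨y, hy, rfl⟩
    exact (hg _).2 (by simpa [mul_assoc] using hy)

variable (Δ) in
/-- The category of reduced positive ribbons. -/
def reducedSubcategory (hΔ : IsMonoidalGarside Δ) : Subcategory (ParabolicSubmonoid Δ) where
  arrows X _ := {f | IsReduced X.carrier (ribbonElt f)}
  id_source {X _ _} _ := hΔ.isReduced_one X.carrier
  id_target {_ Y _} _ := hΔ.isReduced_one Y.carrier
  comp {_ _ _ f g} hf hg :=
    (IsReducedRibbon.mul ⟨ribbonElt_isRibbon f, hf⟩ ⟨ribbonElt_isRibbon g, hg⟩ hΔ).2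

theorem mem_reducedSubcategory (hΔ : IsMonoidalGarside Δ) {X Y : ParabolicSubmonoid Δ}
    (f : X ⟶ Y) : f ∈ (reducedSubcategory Δ hΔ).arrows X Y ↔
      IsReducedRibbon X.carrier Y.carrier (ribbonElt f) :=
  ⟨fun h => ⟨ribbonElt_isRibbon f, h⟩, fun h => h.2⟩

theorem reducedSubcategory_isSublattice_out (hν : IsNuFunction ν) (hν' : IsNuTildeFunction ν')
    (hΔ : IsMonoidalGarside Δ) (X : ParabolicSubmonoid Δ) :
    IsSublattice OutDvd ((reducedSubcategory Δ hΔ).outSet X) := by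
  have := hΔ.cancel
  rintro ⟨Y, g⟩ hg ⟨Z, h⟩ hh
  have hg' := (mem_reducedSubcategory hΔ g).1 hg
  have hh' := (mem_reducedSubcategory hΔ h).1 hh
  obtain ⟨⟨m, hm⟩, d, hd⟩ := hΔ.lattice_left (ribbonElt g) (ribbonElt h)
  have hmr := hg'.isReduced_lcm hh' hΔ hm
  have hdr := hg'.2.of_leftDvd hd.1
  obtain ⟨W, hW⟩ := hν'.isRibbon_lcm hΔ hg'.1 hh'.1 hm
  obtain ⟨V, hV⟩ := hν.isRibbon_gcd hΔ hg'.1 hh'.1 hd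
  obtain ⟨m, rfl⟩ := hW.exists_hom
  obtain ⟨d, rfl⟩ := hV.exists_hom
  refine ⟨⟨⟨W, m⟩, hmr, ?_⟩, ⟨V, d⟩, hdr, ?_⟩
  · simp only [IsLcm, outDvd_iff]
    exact ⟨hm.1, hm.2.1, fun n h1 h2 => hm.2.2 _ h1 h2⟩
  · simp only [IsGcd, outDvd_iff]
    exact ⟨hd.1, hd.2.1, fun n h1 h2 => hd.2.2 _ h1 h2⟩

/-- Here `ν` supplies the lcm's and `ν̃` the gcd's. Reducedness is tested on the target side through
`IsRibbon.isReduced_iff`. -/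
theorem reducedSubcategory_isSublattice_in (hν : IsNuFunction ν) (hν' : IsNuTildeFunction ν')
    (hΔ : IsMonoidalGarside Δ) (X : ParabolicSubmonoid Δ) :
    IsSublattice InDvd ((reducedSubcategory Δ hΔ).inSet X) := by
  have := hΔ.cancel
  rintro ⟨Y, g⟩ hg ⟨Z, h⟩ hh
  have hg' := (mem_reducedSubcategory hΔ g).1 hg
  have hh' := (mem_reducedSubcategory hΔ h).1 hh
  obtain ⟨⟨m, hm⟩, d, hd⟩ := hΔ.lattice_right (ribbonElt g) (ribbonElt h)
  have hmr := hg'.isRightReduced_lcm hh' hΔ hm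
  have hdr := ((hg'.1.isReduced_iff hΔ).1 hg'.2).of_rightDvd hd.1
  obtain ⟨W, hW⟩ := hν.isRibbon_lcm hΔ hg'.1 hh'.1 hm
  obtain ⟨V, hV⟩ := hν'.isRibbon_gcd hΔ hg'.1 hh'.1 hd
  rw [← hW.isReduced_iff hΔ] at hmr
  rw [← hV.isReduced_iff hΔ] at hdr
  obtain ⟨m, rfl⟩ := hW.exists_hom
  obtain ⟨d, rfl⟩ := hV.exists_hom
  refine ⟨⟨⟨W, m⟩, hmr, ?_⟩, ⟨V, d⟩, hdr, ?_⟩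
  · simp only [IsLcm, inDvd_iff]
    exact ⟨hm.1, hm.2.1, fun n h1 h2 => hm.2.2 _ h1 h2⟩
  · simp only [IsGcd, inDvd_iff]
    exact ⟨hd.1, hd.2.1, fun n h1 h2 => hd.2.2 _ h1 h2⟩

/-- The functor induced on the category of reduced positive ribbons by an automorphism that
fixes `Δ`. -/
def reducedFunctor (hΔ : IsMonoidalGarside Δ) (Ψ : M ≃* M) (hΨ : Ψ Δ = Δ) :
    (reducedSubcategory Δ hΔ).Obj ⥤ (reducedSubcategory Δ hΔ).Obj where
  obj X := ⟨X.1.map Ψ hΨ, hΔ.isReduced_one _⟩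
  map f :=
    have := hΔ.cancel
    ⟨(⟨Ψ (ribbonElt f.1), ((ribbonElt_isRibbon f.1).map Ψ hΨ).exists_equiv⟩ : PositiveRibbon _ _),
      (((mem_reducedSubcategory hΔ f.1).1 f.2).map Ψ hΨ).2⟩
  map_id _ := Subtype.ext (PositiveRibbon.ext (map_one Ψ))
  map_comp _ _ := Subtype.ext (PositiveRibbon.ext (map_mul Ψ _ _))

theorem reducedFunctor_isAutomorphism (hΔ : IsMonoidalGarside Δ) (Ψ : M ≃* M) (hΨ : Ψ Δ = Δ) :
    Function.Bijective (reducedFunctor hΔ Ψ hΨ).obj ∧ (reducedFunctor hΔ Ψ hΨ).Full ∧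
      (reducedFunctor hΔ Ψ hΨ).Faithful := by
  have := hΔ.cancel
  have hΨ' : Ψ.symm Δ = Δ := by rw [MulEquiv.symm_apply_eq, hΨ]
  refine ⟨⟨fun X Y h => Subtype.ext (ParabolicSubmonoid.map_injective Ψ hΨ
    (congrArg Subtype.val h)), fun X => ⟨⟨X.1.map Ψ.symm hΨ', hΔ.isReduced_one _⟩,
      Subtype.ext (X.1.map_map_symm Ψ hΨ hΨ')⟩⟩, ⟨@fun X Y f => ?_⟩,
      ⟨fun {_ _} f g h => ?_⟩⟩
  · have hf : IsReducedRibbon (X.1.map Ψ hΨ).carrier (Y.1.map Ψ hΨ).carrier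
        (Ψ (Ψ.symm (ribbonElt f.1))) := by
      rw [Ψ.apply_symm_apply]
      exact (mem_reducedSubcategory hΔ f.1).1 f.2
    obtain ⟨g, hg⟩ := hf.of_map.1.exists_hom
    refine ⟨⟨g, ((mem_reducedSubcategory hΔ g).2 (hg ▸ hf.of_map))⟩,
      Subtype.ext (PositiveRibbon.ext ?_)⟩
    change Ψ (ribbonElt g) = ribbonElt f.1
    rw [hg, Ψ.apply_symm_apply]
  · have h' := congrArg (fun k => ribbonElt k.1) h
    exact Subtype.ext (PositiveRibbon.ext (Ψ.injective h'))

theorem reducedSubcategory_isParabolic (hν : IsNuFunction ν) (hν' : IsNuTildeFunction ν')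
    (hΔ : IsMonoidalGarside Δ) {D : ∀ X : ParabolicSubmonoid Δ, Out X}
    (hD : ∀ X, ribbonElt (D X).2 = Δ) : (reducedSubcategory Δ hΔ).IsParabolic D := by
  have := hΔ.cancel
  refine ⟨fun X => reducedSubcategory_isSublattice_out hν hν' hΔ X.1,
    fun X => reducedSubcategory_isSublattice_in hν hν' hΔ X.1, ?_⟩
  obtain ⟨Ψ, hΨ, hc⟩ := hΔ.exists_automorphism_pow 1
  simp only [pow_one] at hc
  choose δ hδ r hr hδr hδX using fun X : ParabolicSubmonoid Δ => X.exists_reduced_garside hΔ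
  have hrr : ∀ X, IsRibbon X.carrier (X.map Ψ hΨ).carrier (r X) := fun X =>
    (hδX X).of_mul_left (by rw [hδr]; exact X.isRibbon_map hΨ hc)
  refine ⟨reducedFunctor hΔ Ψ hΨ, reducedFunctor_isAutomorphism hΔ Ψ hΨ,
    { app := fun X => (⟨r X.1, (hrr X.1).exists_equiv⟩ : PositiveRibbon _ _)
      naturality := fun X Y f => PositiveRibbon.ext ?_ }, fun X => ?_⟩
  · have hf := (mem_reducedSubcategory hΔ f.1).1 f.2
    change ribbonElt f.1 * r Y.1 = r X.1 * Ψ (ribbonElt f.1)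
    -- With `a f = f δ_Y`, the relation `f Δ = Δ Ψ(f)` reads `a (f r_Y) = δ_X (r_X Ψ(f))`. Both
    -- parentheses are reduced, so they agree.
    obtain ⟨a, ha, haδ⟩ := hf.1.2 _ (hδ Y.1)
    refine (IsReduced.mul_eq_mul (hf.mul ⟨hrr Y.1, hr Y.1⟩ hΔ).2
      (IsReducedRibbon.mul ⟨hrr X.1, hr X.1⟩ (hf.map Ψ hΨ) hΔ).2 hΔ ha (hδ X.1) ?_).2
    rw [← mul_assoc, haδ, mul_assoc, hδr, hc, ← mul_assoc, hδr]
  · have hrΔ : ∃ c ∈ (X.1.map Ψ hΨ).carrier, r X.1 * c = Δ := by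
      obtain ⟨c, hc, h⟩ := (hrr X.1).1 _ (hδ X.1)
      exact ⟨c, hc, by rw [← h, hδr]⟩
    constructor
    · ext ⟨W, f⟩
      simp only [Set.mem_ofPred_eq, Set.mem_inter_iff, outDvd_iff, hD]
      change LeftDvd (ribbonElt f) (r X.1) ↔ LeftDvd (ribbonElt f) Δ ∧
        IsReduced X.1.carrier (ribbonElt f)
      obtain ⟨c, hcX, hrc⟩ := hrΔ
      constructor
      · exact fun h => ⟨h.trans ⟨c, hrc⟩, (hr X.1).of_leftDvd h⟩
      · rintro ⟨h1, h2⟩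
        -- The lcm `r_X k` is a reduced ribbon dividing `Δ = r_X c` with `c` in `Ψ(X)`. So `k`
        -- divides `c` and lies in `Ψ(X)`, yet is reduced for `Ψ(X)`: thus `k = 1`.
        obtain ⟨⟨m, hm⟩, -⟩ := hΔ.lattice_left (ribbonElt f) (r X.1)
        have hmr := IsReducedRibbon.isReduced_lcm ⟨ribbonElt_isRibbon f, h2⟩ ⟨hrr X.1, hr X.1⟩ hΔ hm
        obtain ⟨V, hV⟩ := hν'.isRibbon_lcm hΔ (ribbonElt_isRibbon f) (hrr X.1) hm
        have hmΔ := hm.2.2 Δ h1 ⟨c, hrc⟩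
        obtain ⟨h3, ⟨k, rfl⟩, -⟩ := hm
        have hk := (IsReducedRibbon.of_mul_left (hrr X.1) ⟨hV, hmr⟩ hΔ).2
        replace hmΔ : LeftDvd (r X.1 * k) (r X.1 * c) := by rwa [hrc]
        have hk1 : k = 1 := hk k ((X.1.map Ψ hΨ).mem_of_leftDvd hΔ hmΔ.of_mul_left hcX) (.refl k)
        rwa [hk1, mul_one] at h3
    · ext f
      simp only [Set.mem_ofPred_eq, Set.mem_inter_iff, IsGcd, outDvd_iff, hD]
      constructor
      · rintro ⟨h1, h2⟩
        exact ⟨f, h2, h1, .refl _, fun _ _ h => h⟩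
      · rintro ⟨p, hp, h1, h2, -⟩
        exact ⟨h1, IsReduced.of_leftDvd hp h2⟩

theorem nuGroupoid_eq_generated (hν : IsNuFunction ν) (hΔ : IsMonoidalGarside Δ) :
    nuGroupoid ι ν = Subgroupoid.generated (imageEdges ι (reducedSubcategory Δ hΔ)) := by
  have := hΔ.cancel
  refine le_antisymm (hν.nuGroupoid_le hΔ (fun H => ?_) fun {X Y g} hg => ?_) (generated_le ?_)
  · obtain ⟨X, rfl⟩ := H.exists_toSubgroup_eq
    exact Subgroupoid.subset_generated _ _ _
      ⟨X, X, 𝟙 X, hΔ.isReduced_one _, rfl, rfl, (map_one ι).symm⟩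
  · obtain ⟨f, rfl⟩ := hg.1.exists_hom
    exact Subgroupoid.subset_generated _ _ _ ⟨X, Y, f, hg.2, rfl, rfl, rfl⟩
  · rintro _ _ f ⟨X, Y, g, hg, rfl, rfl, hf⟩
    have hg' := (mem_reducedSubcategory hΔ g).1 hg
    obtain rfl : hg'.1.toConj ι = f := conjElt_injective hf.symm
    exact hν.mem_nuGroupoid hΔ hg'

theorem isStandardParabolicSubgroupoid_nuGroupoid (hν : IsNuFunction ν)
    (hν' : IsNuTildeFunction ν') (hΔ : IsMonoidalGarside Δ) :
    IsStandardParabolicSubgroupoid (nuGroupoid ι ν) := by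
  have := hΔ.cancel
  obtain ⟨Ψ, hΨ, hc⟩ := hΔ.exists_automorphism_pow 1
  simp only [pow_one] at hc
  choose f hf using fun X : ParabolicSubmonoid Δ => (X.isRibbon_map hΨ hc).exists_hom
  exact ⟨fun X => ⟨_, f X⟩, hf, reducedSubcategory Δ hΔ,
    reducedSubcategory_isParabolic hν hν' hΔ hf, nuGroupoid_eq_generated hν hΔ⟩

end Main

end GarsideRibbon

theorem theorem1p3 {M : Type u} [Monoid M] {A : Type v} [Group A] (Δ : M)
    (hΔ : GarsideRibbon.IsMonoidalGarside Δ)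
    (ι : M →* A) (hι : GarsideRibbon.IsGroupOfFractions ι)
    (ν : ∀ X : GarsideRibbon.ParabolicSubmonoid Δ, GarsideRibbon.Atoms M → GarsideRibbon.Out X)
    (hν : GarsideRibbon.IsNuFunction ν)
    (ν' : ∀ X : GarsideRibbon.ParabolicSubmonoid Δ, GarsideRibbon.Atoms M → GarsideRibbon.In X)
    (hν' : GarsideRibbon.IsNuTildeFunction ν') :
    -- (i)
    GarsideRibbon.IsSemidirectProduct (GarsideRibbon.ribbonGroupoid ι Δ)
      (GarsideRibbon.quasiCentralizerGroupoid ι Δ) (GarsideRibbon.nuGroupoid ι ν) ∧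
    -- (ii)
    GarsideRibbon.IsSemidirectProduct (⊤ : Subgroupoid (GarsideRibbon.ParabolicSubgroup ι Δ))
      (GarsideRibbon.parabolicGroupoid ι Δ) (GarsideRibbon.nuGroupoid ι ν) ∧
    -- the vertex groups of Conj(A) are the normalizers of the parabolic subgroups
    (∀ H : GarsideRibbon.ParabolicSubgroup ι Δ,
      Set.range (fun f : H ⟶ H => GarsideRibbon.conjElt f) =
        (Subgroup.normalizer (H.carrier : Set A) : Set A)) ∧
    -- the factor R^ν(A) is a standard parabolic subgroupoid of R(A)
    GarsideRibbon.IsStandardParabolicSubgroupoid (GarsideRibbon.nuGroupoid ι ν) := by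
  have hconj := GarsideRibbon.isSemidirectProduct_conj hν hν' hΔ hι
  refine ⟨?_, hconj, GarsideRibbon.range_conjElt,
    GarsideRibbon.isStandardParabolicSubgroupoid_nuGroupoid hν hν' hΔ⟩
  rw [GarsideRibbon.quasiCentralizerGroupoid_eq]
  exact hconj.inf (GarsideRibbon.nuGroupoid_le_ribbonGroupoid hν hΔ hι)
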